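/- **Model.** Let $(\mathcal V,\mathcal L)$ be a finite directed graph without self-loops, where link $\ell\in\mathcal L$ can transmit at most $C_\ell\in\{0,1,2,\dots\}$ packets per time slot. Let $\overline{\mathcal L}=\mathcal L\cup\{(v,v):v\in\mathcal V\}$ (self-loops have infinite capacity), and let $\mathcal O(v),\mathcal I(v)\subseteq\overline{\mathcal L}$ be the links out of and into $v$. There are finitely many packet types $j\in[J]$ with source $s_j$, destination $z_j$, deadline $d_j\in\{0,1,2,\dots\}$ and weight $w_j\ge 0$; $d_{\max}=\max_j d_j$. In slot $t\in\{1,\dots,T\}$, a random number $a_j^t$ of type-$j$ packets arrive. A route-schedule of type $j$ is a directed walk $k=(k_0,\dots,k_{d_j})$ in $(\mathcal V,\overline{\mathcal L})$ with $k_0\in\mathcal O(s_j)$ and $k_{d_j}\in\mathcal I(z_j)$; $\mathcal K_j$ is the set of these. $L$ is the largest number of edges in $\mathcal L$ (counted with multiplicity) of a route-schedule of any type, and $C_{\min}=\min_{\ell\in\mathcal L}C_\ell$. **Benchmark.** $W^\star_{RI(T)}$ is the maximum of $\sum_{t=1}^T\sum_j w_j\sum_{n=1}^{a_j^t}\sum_{k\in\mathcal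 K_j}y_{jk}^{nt}$ over $y_{jk}^{nt}\in\{0,1\}$ such that $\sum_{k\in\mathcal K_j} y_{jk}^{nt}\le 1$ for all $j$, $1\le t\le T$, $1\le n\le a_j^t$, and, for all $\ell\in\mathcal L$ and $1\le t\le T+d_{\max}$, $\sum_{\tau}\sum_j\sum_{n=1}^{a_j^\tau}\sum_{k\in\mathcal K_j:\,k_{t-\tau}=\ell}y_{jk}^{n\tau}\le C_\ell$, where $\tau$ ranges over the slots in $\{t-d_{\max},\dots,t\}\cap\{1,\dots,T\}$. **Algorithm FBPF** (input $\epsilon>0$ and the rates $\lambda_j$). Take any optimal solution $f$ of the linear program: maximize $\sum_j w_j\lambda_j\sum_{\ell\in\mathcal O(s_j)}f_{j\ell}^0$ subject to $f\ge 0$; $\sum_{\ell\in\mathcal O(s_j)}f_{j\ell}^0\le 1$; $\sum_{\ell\in\mathcal I(v)}f_{j\ell}^{\tau-1}=\sum_{\ell\in\mathcal O(v)}f_{j\ell}^{\tau}$ for all $v$, $j$, $1\le\tau\le d_j$; $f_{j\ell}^0=0$ for $\ell\notin\mathcal O(s_j)$ and $f_{j\ell}^{d_j}=0$ for $\ell\notin\mathcal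 I(z_j)$; and $\sum_j\sum_{\tau=0}^{d_j}\lambda_jf_{j\ell}^\tau\le C_\ell/(1+\epsilon)$ for $\ell\in\mathcal L$. In each slot, every type-$j$ packet of age $\tau\in\{0,\dots,d_j\}$ in the network, located at node $v$, selects a link $\ell\in\mathcal O(v)$, independently of everything else: with probability $f_{j\ell}^0$ if $\tau=0$ (with the remaining probability it is dropped), and with probability $f_{j\ell}^\tau/\sum_{\ell'\in\mathcal O(v)}f_{j\ell'}^\tau$ if $\tau\ge 1$. The packets are processed in an arbitrary order; each one is forwarded over its selected link if that link still has capacity in this slot, and is dropped otherwise. Packets present after slot $T$ continue to be forwarded until they expire. $W_{FBPF}$ is the total weight of the packets forwarded over a whole route-schedule of their type. **Theorem 3.** Suppose that the arrival rates are stationary, $\mathbb E[a_j^t]=\lambda_j$ for all $t\in\{1,\dots,T\}$, and that the arrival processes of different types are independent (arrivals of one type may be dependent within and across slots). Suppose that, for every type $j$ and every window $\{t-d_{\max},\dots,t\}\cap\{1,\dots,T\}$, $1\le t\le T+d_{\max}$, the type-$j$ packet arrivals in the window can be partitioned into independent groups of at most $D$ packets: the vector of the numbers $a_j^\tau$, $\tau$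 in the window, has the law of a finite sum of independent vectors with nonnegative integer entries, each with entries summing to at most $D$ almost surely. Let $\epsilon\in(0,1/3)$, $C_{\min}\ge 2D\left(\frac{1+\epsilon}{\epsilon}\right)^2\log(L/\epsilon)$ (no condition if $L=0$) and $T\ge 2d_{\max}^2/\epsilon$. Then $$\mathbb E[W_{FBPF}]\ \ge\ (1-3\epsilon)\,\mathbb E[W^\star_{RI(T)}].$$ -/

import Mathlib

open MeasureTheory ProbabilityTheory

noncomputable section

/-- A communication network on the node set `V`, shared by the packet types `J`. A link is an ordered
pair of distinct nodes; `cap ℓ` is the number of packets that link `ℓ ∈ links` can carry per slot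
(its values outside `links` are never used). Type `j` has a source, a destination, an end-to-end
deadline and a nonnegative weight. -/
structure Network (V J : Type*) where
  links : Finset (V × V)
  loopless : ∀ v, (v, v) ∉ links
  cap : V × V → ℕ
  src : J → V
  dst : J → V
  deadline : J → ℕ
  weight : J → ℝ
  weight_nonneg : ∀ j, 0 ≤ weight j

/-- A packet is `(j, t, n)`: the `n`-th (`n = 1, 2, …`) packet of type `j` arriving in slot `t`. -/
abbrev Packet (J : Type*) := J × ℕ × ℕ

/-- The outcome of a random link selection: a link, or `none` (the packet is dropped). -/
def Selection (V : Type*) := Option (V × V)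

instance (V : Type*) : MeasurableSpace (Selection V) := ⊤

namespace Network

variable {V J : Type*} [Fintype V] [DecidableEq V] [Fintype J] (N : Network V J)

/-- The links together with one self-loop per node; self-loops have unlimited capacity. -/
def allLinks : Finset (V × V) := N.links ∪ Finset.univ.image fun v => (v, v)

/-- Links of the self-looped graph that leave `v`. -/
def outLinks (v : V) : Finset (V × V) := N.allLinks.filter fun ℓ => ℓ.1 = v

/-- Links of the self-looped graph that enter `v`. -/
def inLinks (v : V) : Finset (V × V) := N.allLinks.filter fun ℓ => ℓ.2 = v

/-- The maximum deadline. -/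
def dmax : ℕ := Finset.univ.sup N.deadline

/-- Sequences of `d_j + 1` ordered pairs of nodes. -/
abbrev Route (j : J) := Fin (N.deadline j + 1) → V × V

/-- The relative route-schedules of type `j`: directed walks with `d_j + 1` edges in the self-looped
graph, from the source to the destination of `j`. -/
def routeSchedules (j : J) : Finset (N.Route j) :=
  Finset.univ.filter fun k =>
    (∀ τ, k τ ∈ N.allLinks) ∧
    (∀ τ : Fin (N.deadline j), (k τ.castSucc).2 = (k τ.succ).1) ∧
    (k 0).1 = N.src j ∧ (k (Fin.last _)).2 = N.dst j

/-- The edge `k_τ`, which is `none` (`∅`) for `τ > d_j`. -/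
def edgeAt {j : J} (k : N.Route j) (τ : ℕ) : Option (V × V) :=
  if h : τ < N.deadline j + 1 then some (k ⟨τ, h⟩) else none

/-- `L`, the maximum length of a packet's route: the largest number of transmissions over (non-self-loop)
links in a route-schedule. -/
def maxRouteLength : ℕ :=
  Finset.univ.sup fun j => (N.routeSchedules j).sup fun k =>
    (Finset.univ.filter fun τ => k τ ∈ N.links).card

/-- The arrival slots `(t - d_max)^+, …, min t T` inside the horizon `1, …, T`. -/
def window (T t : ℕ) : Finset ℕ := Finset.Icc (max 1 (t - N.dmax)) (min t T)

/-! ### The random integer problem -/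

/-- Scheduling decisions: `y j t n k` says whether packet `(j, t, n)` is scheduled over `k`. -/
abbrev Decisions := (j : J) → ℕ → ℕ → N.Route j → ℕ

/-- Feasibility of decisions for the arrival sequence `A` (`A j t` packets of type `j` in slot `t`). -/
structure RIFeasible (T : ℕ) (A : J → ℕ → ℕ) (y : N.Decisions) : Prop where
  one_choice : ∀ t ∈ Finset.Icc 1 T, ∀ j, ∀ n ∈ Finset.Icc 1 (A j t),
    ∑ k ∈ N.routeSchedules j, y j t n k ≤ 1
  capacity : ∀ ℓ ∈ N.links, ∀ t ∈ Finset.Icc 1 (T + N.dmax),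
    ∑ τ ∈ N.window T t, ∑ j, ∑ n ∈ Finset.Icc 1 (A j τ),
      ∑ k ∈ (N.routeSchedules j).filter (fun k => N.edgeAt k (t - τ) = some ℓ), y j τ n k
      ≤ N.cap ℓ
  binary : ∀ j t n k, y j t n k = 0 ∨ y j t n k = 1

/-- Total weight of the packets scheduled by `y`. -/
def reward (T : ℕ) (A : J → ℕ → ℕ) (y : N.Decisions) : ℝ :=
  ∑ t ∈ Finset.Icc 1 T, ∑ j, N.weight j *
    ∑ n ∈ Finset.Icc 1 (A j t), ∑ k ∈ N.routeSchedules j, (y j t n k : ℝ)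

/-- Optimal value of the random integer problem for the arrival sequence `A`. -/
def optRI (T : ℕ) (A : J → ℕ → ℕ) : ℝ :=
  sSup {r | ∃ y : N.Decisions, N.RIFeasible T A y ∧ r = N.reward T A y}

/-! ### The linear program for the forwarding variables -/

/-- Forwarding variables: `f j ℓ τ` for type `j`, link `ℓ` and age `τ`. -/
abbrev Forwarding (V J : Type*) := J → V × V → ℕ → ℝ

/-- The constraints of the linear program with arrival rates `lam` and parameter `ε`. -/
structure LPFeasible (lam : J → ℝ) (ε : ℝ) (f : Forwarding V J) : Prop where
  one_choice : ∀ j, ∑ ℓ ∈ N.outLinks (N.src j), f j ℓ 0 ≤ 1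
  conservation : ∀ v, ∀ j, ∀ τ ∈ Finset.Icc 1 (N.deadline j),
    ∑ ℓ ∈ N.inLinks v, f j ℓ (τ - 1) = ∑ ℓ ∈ N.outLinks v, f j ℓ τ
  start : ∀ j, ∀ ℓ ∈ N.allLinks, ℓ ∉ N.outLinks (N.src j) → f j ℓ 0 = 0
  finish : ∀ j, ∀ ℓ ∈ N.allLinks, ℓ ∉ N.inLinks (N.dst j) → f j ℓ (N.deadline j) = 0
  capacity : ∀ ℓ ∈ N.links,
    ∑ j, ∑ τ ∈ Finset.range (N.deadline j + 1), lam j * f j ℓ τ ≤ (N.cap ℓ : ℝ) / (1 + ε)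
  nonneg : ∀ j, ∀ ℓ ∈ N.allLinks, ∀ τ ≤ N.dmax, 0 ≤ f j ℓ τ

/-- The objective of the linear program. -/
def lpObjective (lam : J → ℝ) (f : Forwarding V J) : ℝ :=
  ∑ j, N.weight j * lam j * ∑ ℓ ∈ N.outLinks (N.src j), f j ℓ 0

/-- `f` is an optimal solution of the linear program. -/
def LPOptimal (lam : J → ℝ) (ε : ℝ) (f : Forwarding V J) : Prop :=
  N.LPFeasible lam ε f ∧ ∀ g, N.LPFeasible lam ε g → N.lpObjective lam g ≤ N.lpObjective lam f

/-! ### Flow-based probabilistic forwarding -/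

/-- Probability that a type-`j` packet of age `τ` at node `v` selects `ℓ`; the remaining
probability is that of selecting no link, i.e. of being dropped. -/
def selectProb (f : Forwarding V J) (j : J) (τ : ℕ) (v : V) (ℓ : V × V) : ℝ :=
  if ℓ ∈ N.outLinks v then
    if τ = 0 then f j ℓ 0 else f j ℓ τ / ∑ ℓ' ∈ N.outLinks v, f j ℓ' τ
  else 0

/-- `sel p τ v` is the random selection made for packet `p` if it is at node `v` with age `τ`:
the selections are mutually independent and have the prescribed probabilities. -/
structure IsSelection {Ω : Type*} [MeasurableSpace Ω] (P : Measure Ω) (f : Forwarding V J)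
    (sel : Packet J → ℕ → V → Ω → Selection V) : Prop where
  measurable : ∀ p τ v, Measurable (sel p τ v)
  indep : iIndepFun (fun (i : Packet J × ℕ × V) => sel i.1 i.2.1 i.2.2) P
  prob : ∀ (p : Packet J) (τ : ℕ) (v : V) (ℓ : V × V), τ ≤ N.deadline p.1 →
    P.real {ω | sel p τ v ω = some ℓ} = N.selectProb f p.1 τ v ℓ

section Execution

variable (T : ℕ) (A : J → ℕ → ℕ) (S : Packet J → ℕ → V → Selection V) (R : ℕ → Packet J → ℕ)

/-- The node of packet `p` at the beginning of slot `t`, if `p` is in the network and unexpired.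
`prev` gives, for each packet, the link over which it was forwarded in slot `t - 1`, if any. -/
def nodeAt (prev : Packet J → Option (V × V)) (t : ℕ) (p : Packet J) : Option V :=
  if p.2.1 = t then
    if t ∈ Finset.Icc 1 T ∧ p.2.2 ∈ Finset.Icc 1 (A p.1 t) then some (N.src p.1) else none
  else if p.2.1 < t ∧ t ≤ p.2.1 + N.deadline p.1 then (prev p).map Prod.snd
  else none

/-- The link selected for packet `p` in slot `t`, if any. -/
def requestAt (prev : Packet J → Option (V × V)) (t : ℕ) (p : Packet J) : Option (V × V) :=
  (N.nodeAt T A prev t p).bind fun v => S p (t - p.2.1) v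

/-- The link over which packet `p` is forwarded in slot `t`, if any. Packets are processed in the order
of their ranks `R t`; a packet is forwarded over its selected link if fewer than `cap ℓ` packets
processed before it in this slot have selected this link, and is dropped otherwise. -/
def forwardAt (prev : Packet J → Option (V × V)) (t : ℕ) (p : Packet J) : Option (V × V) :=
  (N.requestAt T A S prev t p).bind fun ℓ =>
    if ℓ ∈ N.links →
      {q | N.requestAt T A S prev t q = some ℓ ∧ R t q < R t p}.ncard < N.cap ℓ
    then some ℓ else none

/-- The execution: the link over which each packet is forwarded in each slot `t = 1, 2, …`. -/
def sent : ℕ → Packet J → Option (V × V)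
  | 0 => fun _ => none
  | t + 1 => N.forwardAt T A S R (sent t) (t + 1)

/-- The decisions made by the algorithm: packet `(j, t, n)` is scheduled over `k` if it has been
forwarded over all the edges of `k` in the slots `t, …, t + d_j`. -/
def fbpfDecisions : N.Decisions := fun j t n k =>
  if ∀ τ : Fin (N.deadline j + 1), N.sent T A S R (t + τ) (j, t, n) = some (k τ) then 1 else 0

/-- The objective value attained by the algorithm. -/
def fbpfReward : ℝ := N.reward T A (N.fbpfDecisions T A S R)

end Execution

end Network

/-- The packets counted by the `ℕ`-valued variables `X s` (`s` ranging over the slots of a window) can be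
partitioned into finitely many independent groups of at most `D` packets each: in distribution,
the vector `X` is a sum of independent `ℕ`-valued vectors, each of total at most `D`. -/
def DependencyDegreeLE {Ω ι : Type*} [MeasurableSpace Ω] [Fintype ι] (P : Measure Ω)
    (X : ι → Ω → ℕ) (D : ℕ) : Prop :=
  ∃ (m : ℕ) (ν : Fin m → ProbabilityMeasure (ι → ℕ)),
    (∀ i, ∀ᵐ z ∂(ν i : Measure (ι → ℕ)), ∑ s, z s ≤ D) ∧
    P.map (fun ω s => X s ω) =
      (Measure.pi fun i => (ν i : Measure (ι → ℕ))).map (fun z s => ∑ i, z i s)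

/-- An algorithm with random objective value `W` provides a `γ`-approximation to a problem with
random optimal value `Wopt`: both expectations exist and `E[W] ≥ γ E[Wopt]`. -/
def ProvidesApproximation {Ω : Type*} [MeasurableSpace Ω] (P : Measure Ω) (γ : ℝ)
    (W Wopt : Ω → ℝ) : Prop :=
  Integrable W P ∧ Integrable Wopt P ∧ γ * ∫ ω, Wopt ω ∂P ≤ ∫ ω, W ω ∂P

end

/-! Compare the algorithm with packets that follow their selections regardless of capacity. By flow
conservation, the probability that such a free walk uses link `ℓ` at age `τ` is exactly the LP
variable (`IsSelection.prob_walkLink`). The terminal constraint then makes a walk that survives age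
`0` almost surely a route-schedule, so the free walks earn, in expectation, at least `T` times the
LP objective (`IsSelection.le_sum_routeProb`, `integral_walkWeight_arrivals`).

Real packets on a link form a subset of the free walkers on it. A packet whose walk is a
route-schedule is therefore delivered in any processing order unless some link of its route is
overloaded by free walkers (`walkWeight_le`). In every slot, the LP keeps the mean load of a link at
`C / (1 + ε)` or less. An exponential-moment bound, conditional on the arrivals and then averaged
over them, shows that each link of the route loses at most a fraction `(1 + ε) * (ε / L)` of the
weight. A route has at most `L` links, so at most a fraction `(1 + ε) * ε` is lost in all
(`integral_overloadWeight_arrivals_le`).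

Two points make the averaging work. Convexity and AM-GM show that a group of at most `D` packets has
exponential moments no larger than those of a single block of `D` packets with the same thinned mean
(`prod_one_add_mul_pow_le`). Summing over the packets of a slot weights the tail by the number of
arrivals; this size-biasing affects one group only and costs one factor `r ^ D = 1 + ε`
(`DependencyDegreeLE.moment_bounds`).

For the benchmark, average the optimal integer solutions over the arrivals and divide by `(T + dmax)
* (1 + ε)` and by the rates. The result is LP feasible, so the expected optimum is at most `(T +
dmax) * (1 + ε)` times the LP objective (`integral_optRI_le`). The horizon condition gives `dmax ≤ ε
* T / 2`, and a polynomial inequality in `ε` finishes. -/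

noncomputable section

set_option linter.unusedSectionVars false

/-! ### The finite set of arrived packets. -/

/-- The packets arriving in the slots `1, …, T`. -/
def arrivedPackets {J : Type*} [Fintype J] (T : ℕ) (A : J → ℕ → ℕ) : Finset (Packet J) :=
  (Finset.univ ×ˢ Finset.Icc 1 T ×ˢ Finset.Icc 1 (∑ j, ∑ t ∈ Finset.Icc 1 T, A j t)).filter
    fun p => p.2.2 ≤ A p.1 p.2.1

section ArrivedPackets

variable {J : Type*} [Fintype J]

theorem mem_arrivedPackets {T : ℕ} {A : J → ℕ → ℕ} {p : Packet J} :
    p ∈ arrivedPackets T A ↔ p.2.1 ∈ Finset.Icc 1 T ∧ p.2.2 ∈ Finset.Icc 1 (A p.1 p.2.1) := by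
  obtain ⟨j, t, n⟩ := p
  simp only [arrivedPackets, Finset.mem_filter, Finset.mem_product, Finset.mem_univ, true_and,
    Finset.mem_Icc]
  constructor
  · rintro ⟨⟨h1, h2⟩, h3⟩
    exact ⟨h1, h2.1, h3⟩
  · rintro ⟨h1, h2⟩
    refine ⟨⟨h1, h2.1, h2.2.trans ?_⟩, h2.2⟩
    calc A j t ≤ ∑ t ∈ Finset.Icc 1 T, A j t :=
          Finset.single_le_sum (f := fun t => A j t) (fun _ _ => Nat.zero_le _)
            (Finset.mem_Icc.2 h1)
      _ ≤ _ := Finset.single_le_sum (f := fun j => ∑ t ∈ Finset.Icc 1 T, A j t)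
            (fun _ _ => Nat.zero_le _) (Finset.mem_univ j)

theorem prod_arrivedPackets {M : Type*} [CommMonoid M] (T : ℕ) (A : J → ℕ → ℕ)
    (g : Packet J → M) :
    ∏ p ∈ arrivedPackets T A, g p =
      ∏ j, ∏ t ∈ Finset.Icc 1 T, ∏ n ∈ Finset.Icc 1 (A j t), g (j, t, n) := by
  classical
  rw [Finset.prod_sigma', Finset.prod_sigma']
  refine Finset.prod_bij' (fun p _ => ⟨⟨p.1, p.2.1⟩, p.2.2⟩) (fun x _ => (x.1.1, x.1.2, x.2))
    ?_ ?_ ?_ ?_ ?_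
  · intro p hp
    rw [mem_arrivedPackets] at hp
    simpa using hp
  · intro x hx
    rw [mem_arrivedPackets]
    simpa using hx
  · intros; rfl
  · intros; rfl
  · intros; rfl

theorem sum_arrivedPackets {M : Type*} [AddCommMonoid M] (T : ℕ) (A : J → ℕ → ℕ)
    (g : Packet J → M) :
    ∑ p ∈ arrivedPackets T A, g p =
      ∑ j, ∑ t ∈ Finset.Icc 1 T, ∑ n ∈ Finset.Icc 1 (A j t), g (j, t, n) :=
  prod_arrivedPackets (M := Multiplicative M) T A g

theorem prod_arrivedPackets_const {M : Type*} [CommMonoid M] (T : ℕ) (A : J → ℕ → ℕ)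
    (g : J → ℕ → M) :
    ∏ p ∈ arrivedPackets T A, g p.1 p.2.1 = ∏ j, ∏ t ∈ Finset.Icc 1 T, g j t ^ A j t := by
  rw [prod_arrivedPackets]
  simp

end ArrivedPackets

/-! ### Capacity-free walks and their comparison with the execution. -/

namespace Network

variable {V J : Type*} [Fintype V] [DecidableEq V] [Fintype J] (N : Network V J)

/-- The node of a type-`j` packet of age `τ` that follows the selections `s` regardless of
capacities. -/
def walkNode (j : J) (s : ℕ → V → Selection V) : ℕ → Option V
  | 0 => some (N.src j)
  | τ + 1 => ((walkNode j s τ).bind fun v => s τ v).map Prod.snd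

/-- The link used at age `τ` by a type-`j` packet that follows the selections `s` regardless of
capacities. -/
def walkLink (j : J) (s : ℕ → V → Selection V) (τ : ℕ) : Option (V × V) :=
  (N.walkNode j s τ).bind fun v => s τ v

theorem walkNode_succ (j : J) (s : ℕ → V → Selection V) (τ : ℕ) :
    N.walkNode j s (τ + 1) = (N.walkLink j s τ).map Prod.snd := rfl

theorem walkLink_of_walkNode {j : J} {s : ℕ → V → Selection V} {τ : ℕ} {v : V}
    (h : N.walkNode j s τ = some v) : N.walkLink j s τ = s τ v := by
  unfold walkLink
  rw [h]
  rfl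

theorem walkLink_eq_some_iff {j : J} {s : ℕ → V → Selection V} {τ : ℕ} {ℓ : V × V} :
    N.walkLink j s τ = some ℓ ↔ ∃ v, N.walkNode j s τ = some v ∧ s τ v = some ℓ :=
  Option.bind_eq_some_iff

theorem walkNode_congr (j : J) {s s' : ℕ → V → Selection V} (τ : ℕ)
    (h : ∀ i < τ, ∀ v, s i v = s' i v) : N.walkNode j s τ = N.walkNode j s' τ := by
  induction τ with
  | zero => rfl
  | succ τ ih =>
    rw [walkNode, walkNode, ih fun i hi => h i (by omega)]
    simp only [h τ (Nat.lt_succ_self _)]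

/-- The packets that would be transmitted over `ℓ` in slot `t` if capacities were unlimited. -/
def walkers (T : ℕ) (A : J → ℕ → ℕ) (S : Packet J → ℕ → V → Selection V) (ℓ : V × V) (t : ℕ) :
    Finset (Packet J) :=
  (arrivedPackets T A).filter fun p =>
    p.2.1 ≤ t ∧ t ≤ p.2.1 + N.deadline p.1 ∧ N.walkLink p.1 (S p) (t - p.2.1) = some ℓ

/-- The selections for which a type-`j` packet walks along `k`. -/
def walkSet (j : J) (k : N.Route j) : Set (ℕ → V → Selection V) :=
  {s | ∀ τ : Fin (N.deadline j + 1), N.walkLink j s τ = some (k τ)}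

open Classical in
/-- The weight of the packets whose unconstrained walk is a route-schedule. -/
def walkWeight (T : ℕ) (A : J → ℕ → ℕ) (S : Packet J → ℕ → V → Selection V) : ℝ :=
  ∑ p ∈ arrivedPackets T A, N.weight p.1 * ∑ k ∈ N.routeSchedules p.1,
    if S p ∈ N.walkSet p.1 k then (1 : ℝ) else 0

open Classical in
/-- The weight of the packets whose unconstrained walk is a route-schedule, counted once for every
overloaded link of the route. -/
def overloadWeight (T : ℕ) (A : J → ℕ → ℕ) (S : Packet J → ℕ → V → Selection V) : ℝ :=
  ∑ p ∈ arrivedPackets T A, N.weight p.1 * ∑ k ∈ N.routeSchedules p.1,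
    ∑ τ : Fin (N.deadline p.1 + 1), if k τ ∈ N.links then
      (if S p ∈ N.walkSet p.1 k ∧ N.cap (k τ) < (N.walkers T A S (k τ) (p.2.1 + τ)).card
        then (1 : ℝ) else 0) else 0

section Execution

variable {T : ℕ} {A : J → ℕ → ℕ} {S : Packet J → ℕ → V → Selection V} {R : ℕ → Packet J → ℕ}

theorem requestAt_eq_some_iff {prev : Packet J → Option (V × V)} {t : ℕ} {p : Packet J}
    {ℓ : V × V} : N.requestAt T A S prev t p = some ℓ ↔
      ∃ v, N.nodeAt T A prev t p = some v ∧ S p (t - p.2.1) v = some ℓ :=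
  Option.bind_eq_some_iff

theorem requestAt_eq_of_forwardAt {prev : Packet J → Option (V × V)} {t : ℕ} {p : Packet J}
    {ℓ : V × V} (h : N.forwardAt T A S R prev t p = some ℓ) :
    N.requestAt T A S prev t p = some ℓ := by
  unfold forwardAt at h
  rw [Option.bind_eq_some_iff] at h
  obtain ⟨ℓ', h1, h2⟩ := h
  split_ifs at h2 with h3
  rw [h1]; exact h2

/-- A packet still in the network has never been dropped, so it stands where its free walk stands.
Actual requests are thus dominated by walkers, whose number does not depend on capacities or on the
processing order. -/
theorem mem_walkers_of_requestAt (t : ℕ) {p : Packet J} {ℓ : V × V}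
    (h : N.requestAt T A S (N.sent T A S R t) (t + 1) p = some ℓ) :
    p ∈ N.walkers T A S ℓ (t + 1) := by
  induction t generalizing p ℓ with
  | zero =>
    obtain ⟨v, h1, h2⟩ := (N.requestAt_eq_some_iff).1 h
    unfold nodeAt at h1
    split_ifs at h1 with h3 h4 h5
    · simp only [Option.some.injEq] at h1
      simp only [walkers, Finset.mem_filter, mem_arrivedPackets]
      rw [h3] at h2 ⊢
      simp only [zero_add, tsub_self] at h2
      refine ⟨h4, le_rfl, by omega, ?_⟩
      rw [tsub_self, N.walkLink_of_walkNode (v := v) (τ := 0) (congrArg some h1)]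
      exact h2
    · simp [sent] at h1
  | succ t ih =>
    obtain ⟨v, h1, h2⟩ := (N.requestAt_eq_some_iff).1 h
    unfold nodeAt at h1
    simp only [walkers, Finset.mem_filter, mem_arrivedPackets]
    split_ifs at h1 with h3 h4 h5
    · simp only [Option.some.injEq] at h1
      rw [h3] at h2 ⊢
      simp only [tsub_self] at h2
      refine ⟨h4, le_rfl, by omega, ?_⟩
      rw [tsub_self, N.walkLink_of_walkNode (v := v) (τ := 0) (congrArg some h1)]
      exact h2
    · rw [Option.map_eq_some_iff] at h1
      obtain ⟨ℓ', h6, rfl⟩ := h1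
      have h7 := ih (requestAt_eq_of_forwardAt N h6)
      simp only [walkers, Finset.mem_filter, mem_arrivedPackets] at h7
      refine ⟨h7.1, by omega, by omega, ?_⟩
      have h8 : t + 1 + 1 - p.2.1 = (t + 1 - p.2.1) + 1 := by omega
      have h9 : N.walkNode p.1 (S p) (t + 1 + 1 - p.2.1) = some ℓ'.2 := by
        rw [h8, walkNode_succ, h7.2.2.2]
        rfl
      rw [N.walkLink_of_walkNode h9]
      exact h2

/-- The packets served ahead of `p` on `ℓ` are walkers other than `p`, hence at most `cap ℓ - 1` of
them, whatever the ranks are. -/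
theorem forwardAt_eq_of_card_le (t : ℕ) {p : Packet J} {ℓ : V × V}
    (h : N.requestAt T A S (N.sent T A S R t) (t + 1) p = some ℓ)
    (hcap : ℓ ∈ N.links → (N.walkers T A S ℓ (t + 1)).card ≤ N.cap ℓ) :
    N.sent T A S R (t + 1) p = some ℓ := by
  classical
  rw [sent, forwardAt, h]
  simp only [Option.bind_some]
  rw [if_pos]
  intro hℓ
  refine lt_of_lt_of_le ?_ (hcap hℓ)
  have hp := mem_walkers_of_requestAt N t h
  rw [← Finset.card_erase_add_one hp, Nat.lt_succ_iff, ← Set.ncard_coe_finset]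
  refine Set.ncard_le_ncard ?_ (Finset.finite_toSet _)
  rintro q ⟨hq1, hq2⟩
  rw [Finset.mem_coe, Finset.mem_erase]
  refine ⟨?_, mem_walkers_of_requestAt N t hq1⟩
  rintro rfl
  exact lt_irrefl _ hq2

theorem sent_eq_of_walkLink_eq {p : Packet J} (hp : p ∈ arrivedPackets T A)
    (k : N.Route p.1) (hk : ∀ τ : Fin (N.deadline p.1 + 1), N.walkLink p.1 (S p) τ = some (k τ))
    (hcap : ∀ τ : Fin (N.deadline p.1 + 1), k τ ∈ N.links →
      (N.walkers T A S (k τ) (p.2.1 + τ)).card ≤ N.cap (k τ)) (τ : Fin (N.deadline p.1 + 1)) :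
    N.sent T A S R (p.2.1 + τ) p = some (k τ) := by
  obtain ⟨τ, hτ⟩ := τ
  have hp' := mem_arrivedPackets.1 hp
  have ht : 1 ≤ p.2.1 := (Finset.mem_Icc.1 hp'.1).1
  induction τ with
  | zero =>
    obtain ⟨t, ht'⟩ : ∃ t, p.2.1 = t + 1 := ⟨p.2.1 - 1, by omega⟩
    have h1 := hcap ⟨0, hτ⟩
    simp only [add_zero, ht'] at h1 ⊢
    refine forwardAt_eq_of_card_le N t ?_ h1
    have h2 := hk ⟨0, hτ⟩
    rw [N.walkLink_of_walkNode (v := N.src p.1) rfl] at h2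
    refine (N.requestAt_eq_some_iff).2 ⟨N.src p.1, ?_, ?_⟩
    · rw [nodeAt, if_pos ht', if_pos (by rw [← ht']; exact hp')]
    · rw [ht', Nat.sub_self]
      exact h2
  | succ τ ih =>
    have h1 := hcap ⟨τ + 1, hτ⟩
    have h0 := ih (by omega)
    simp only at h1 h0 ⊢
    rw [show p.2.1 + (τ + 1) = (p.2.1 + τ) + 1 by omega] at h1 ⊢
    refine forwardAt_eq_of_card_le N _ ?_ h1
    have h2 := hk ⟨τ + 1, hτ⟩
    have h3 := hk ⟨τ, by omega⟩
    simp only at h2 h3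
    have h4 : N.walkNode p.1 (S p) (τ + 1) = some (k ⟨τ, by omega⟩).2 := by
      rw [walkNode_succ, h3]
      rfl
    rw [N.walkLink_of_walkNode h4] at h2
    refine (N.requestAt_eq_some_iff).2 ⟨(k ⟨τ, by omega⟩).2, ?_, ?_⟩
    · rw [nodeAt, if_neg (by omega), if_pos (by omega), h0]
      rfl
    · rw [show p.2.1 + τ + 1 - p.2.1 = τ + 1 by omega]
      exact h2

/-- The algorithm's reward falls short of the weight of the packets whose unconstrained walk is a
route-schedule by at most the weight lost at overloaded links. -/
theorem walkWeight_le (T : ℕ) (A : J → ℕ → ℕ) (S : Packet J → ℕ → V → Selection V)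
    (R : ℕ → Packet J → ℕ) :
    N.walkWeight T A S ≤ N.fbpfReward T A S R + N.overloadWeight T A S := by
  classical
  unfold walkWeight overloadWeight
  have h1 : N.fbpfReward T A S R = ∑ p ∈ arrivedPackets T A, N.weight p.1 *
      ∑ k ∈ N.routeSchedules p.1, (N.fbpfDecisions T A S R p.1 p.2.1 p.2.2 k : ℝ) := by
    rw [sum_arrivedPackets, fbpfReward, reward, Finset.sum_comm]
    simp only [Finset.mul_sum]
  rw [h1, ← Finset.sum_add_distrib]
  refine Finset.sum_le_sum fun p hp => ?_
  rw [← mul_add, ← Finset.sum_add_distrib]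
  refine mul_le_mul_of_nonneg_left (Finset.sum_le_sum fun k _ => ?_) (N.weight_nonneg _)
  have hnn : ∀ τ : Fin (N.deadline p.1 + 1), (0 : ℝ) ≤ if k τ ∈ N.links then
          (if S p ∈ N.walkSet p.1 k ∧
            N.cap (k τ) < (N.walkers T A S (k τ) (p.2.1 + τ)).card then (1 : ℝ) else 0)
          else 0 := by
    intro τ
    split_ifs <;> norm_num
  split_ifs with hw
  -- Either no link of the route is overloaded and the packet is delivered along `k`, or one
  -- overloaded link already contributes `1` to the overload sum.
  · by_cases hcap : ∀ τ : Fin (N.deadline p.1 + 1), k τ ∈ N.links →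
      (N.walkers T A S (k τ) (p.2.1 + τ)).card ≤ N.cap (k τ)
    · have h2 : N.fbpfDecisions T A S R p.1 p.2.1 p.2.2 k = 1 := by
        rw [fbpfDecisions, if_pos]
        exact sent_eq_of_walkLink_eq N hp k hw hcap
      rw [h2, Nat.cast_one]
      exact le_add_of_nonneg_right (Finset.sum_nonneg fun τ _ => hnn τ)
    · push Not at hcap
      obtain ⟨τ, h3, h4⟩ := hcap
      refine le_add_of_nonneg_of_le (Nat.cast_nonneg _) ?_
      refine le_trans ?_ (Finset.single_le_sum (fun τ _ => hnn τ) (Finset.mem_univ τ))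
      rw [if_pos h3, if_pos ⟨hw, h4⟩]
  · exact add_nonneg (Nat.cast_nonneg _) (Finset.sum_nonneg fun τ _ => hnn τ)

end Execution

/-! ### Restriction to the horizon and attainment of the integer optimum. -/

section Truncation

/-- The arrivals in the slots `1, …, T` only. -/
def truncateArrivals (T : ℕ) (A : J → Finset.Icc 1 T → ℕ) : J → ℕ → ℕ := fun j t =>
  if h : t ∈ Finset.Icc 1 T then A j ⟨t, h⟩ else 0

variable {T : ℕ} {A B : J → ℕ → ℕ}

/-- Arrivals in the horizon take values in the countable type `J → Finset.Icc 1 T → ℕ`, on which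
every function is measurable. The congruence lemmas below let all rewards be treated as functions on
that type. -/
theorem truncateArrivals_restrict (A : J → ℕ → ℕ) (j : J) :
    ∀ t ∈ Finset.Icc 1 T, truncateArrivals T (fun j (t : Finset.Icc 1 T) => A j t) j t = A j t := by
  intro t ht
  simp only [truncateArrivals, dif_pos ht]

theorem arrivedPackets_congr (h : ∀ j, ∀ t ∈ Finset.Icc 1 T, A j t = B j t) :
    arrivedPackets T A = arrivedPackets T B := by
  ext p
  rw [mem_arrivedPackets, mem_arrivedPackets]
  exact and_congr_right fun hp => by rw [h _ _ hp]

theorem reward_congr (h : ∀ j, ∀ t ∈ Finset.Icc 1 T, A j t = B j t) (y : N.Decisions) :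
    N.reward T A y = N.reward T B y := by
  refine Finset.sum_congr rfl fun t ht => Finset.sum_congr rfl fun j _ => ?_
  rw [h j t ht]

theorem sent_congr (h : ∀ j, ∀ t ∈ Finset.Icc 1 T, A j t = B j t)
    (S : Packet J → ℕ → V → Selection V) (R : ℕ → Packet J → ℕ) (t : ℕ) :
    N.sent T A S R t = N.sent T B S R t := by
  induction t with
  | zero => rfl
  | succ t ih =>
    have h1 : N.nodeAt T A = N.nodeAt T B := by
      funext prev t p
      unfold nodeAt
      refine if_congr Iff.rfl (if_congr (and_congr_right fun ht => ?_) rfl rfl) rfl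
      rw [h _ _ ht]
    have h2 : N.requestAt T A S = N.requestAt T B S := by
      funext prev t p
      rw [requestAt, requestAt, h1]
    rw [sent, sent, ih]
    funext p
    rw [forwardAt, forwardAt, h2]

theorem fbpfReward_congr (h : ∀ j, ∀ t ∈ Finset.Icc 1 T, A j t = B j t)
    (S : Packet J → ℕ → V → Selection V) (R : ℕ → Packet J → ℕ) :
    N.fbpfReward T A S R = N.fbpfReward T B S R := by
  have h1 : N.fbpfDecisions T A S R = N.fbpfDecisions T B S R := by
    funext j t n k
    simp only [fbpfDecisions, sent_congr N h]
  rw [fbpfReward, fbpfReward, h1, reward_congr N h]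

theorem RIFeasible.congr (h : ∀ j, ∀ t ∈ Finset.Icc 1 T, A j t = B j t) {y : N.Decisions}
    (hy : N.RIFeasible T A y) : N.RIFeasible T B y where
  one_choice t ht j n hn := hy.one_choice t ht j n (by rwa [h j t ht])
  capacity ℓ hℓ t ht := by
    refine le_trans (le_of_eq ?_) (hy.capacity ℓ hℓ t ht)
    refine Finset.sum_congr rfl fun τ hτ => Finset.sum_congr rfl fun j _ => ?_
    rw [h j τ]
    simp only [window, Finset.mem_Icc] at hτ ⊢
    omega
  binary := hy.binary

theorem optRI_congr (h : ∀ j, ∀ t ∈ Finset.Icc 1 T, A j t = B j t) :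
    N.optRI T A = N.optRI T B := by
  unfold optRI
  congr 1
  ext r
  constructor
  · rintro ⟨y, hy, rfl⟩
    exact ⟨y, hy.congr N h, reward_congr N h y⟩
  · rintro ⟨y, hy, rfl⟩
    exact ⟨y, hy.congr N fun j t ht => (h j t ht).symm, (reward_congr N h y).symm⟩

end Truncation

/-- Feasible decisions are infinitely many, being free outside the arrived packets. The reward,
however, depends only on the numbers of scheduled packets per type and slot, which are bounded by
`A`; so it takes finitely many values and the supremum is attained. -/
theorem exists_reward_eq_optRI (T : ℕ) (A : J → ℕ → ℕ) :
    ∃ y : N.Decisions, N.RIFeasible T A y ∧ N.optRI T A = N.reward T A y := by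
  classical
  have hne : {r | ∃ y : N.Decisions, N.RIFeasible T A y ∧ r = N.reward T A y}.Nonempty := by
    refine ⟨_, fun _ _ _ _ => 0, ⟨?_, ?_, ?_⟩, rfl⟩ <;> simp
  have hfin : {r | ∃ y : N.Decisions, N.RIFeasible T A y ∧ r = N.reward T A y}.Finite := by
    let F : (J → Finset.Icc 1 T → ℕ) → ℝ := fun c =>
      ∑ t : Finset.Icc 1 T, ∑ j, N.weight j * (c j t : ℝ)
    refine Set.Finite.subset ((Set.finite_Iic fun (j : J) (t : Finset.Icc 1 T) => A j t).image F) ?_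
    rintro r ⟨y, hy, rfl⟩
    refine ⟨fun j t => ∑ n ∈ Finset.Icc 1 (A j t), ∑ k ∈ N.routeSchedules j, y j t n k, ?_, ?_⟩
    · intro j t
      calc _ ≤ ∑ n ∈ Finset.Icc 1 (A j t), 1 :=
            Finset.sum_le_sum fun n hn => hy.one_choice t t.2 j n hn
        _ = A j t := by simp
    · simp only [F, reward]
      rw [← Finset.sum_coe_sort (Finset.Icc 1 T)]
      push_cast
      rfl
  exact hne.csSup_mem hfin

end Network

/-! ### Law of the capacity-free walks. -/

/-- The rows of a doubly indexed family of independent random variables are independent. -/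
theorem ProbabilityTheory.iIndepFun.rows {ι κ 𝓧 Ω : Type*} [MeasurableSpace 𝓧]
    [MeasurableSpace Ω] {P : Measure Ω} {X : ι → κ → Ω → 𝓧} (mX : ∀ i j, Measurable (X i j))
    (h : iIndepFun (fun (i : ι × κ) => X i.1 i.2) P) : iIndepFun (fun i ω j => X i j ω) P := by
  have := h.isProbabilityMeasure
  have hp : ∀ i j, IsProbabilityMeasure (P.map (X i j)) :=
    fun i j => Measure.isProbabilityMeasure_map (mX i j).aemeasurable
  have h2 : ∀ i, iIndepFun (X i) P := fun i =>
    h.precomp (g := fun j => (i, j)) (Prod.mk_right_injective i)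
  rw [iIndepFun_iff_map_fun_eq_infinitePi_map (fun i => measurable_pi_iff.2 (mX i))]
  have h3 := (iIndepFun_iff_map_fun_eq_infinitePi_map (fun i : ι × κ => mX i.1 i.2)).1 h
  have h4 : ∀ i, P.map (fun ω j => X i j ω) = Measure.infinitePi fun j => P.map (X i j) :=
    fun i => (iIndepFun_iff_map_fun_eq_infinitePi_map (mX i)).1 (h2 i)
  simp only [h4]
  -- Independence means that the joint law is a product, and currying turns the product over pairs
  -- into the product of the row products.
  rw [← Measure.infinitePi_map_curry (fun i j => P.map (X i j)), ← h3,
    Measure.map_map (MeasurableEquiv.curry ι κ 𝓧).measurable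
      (measurable_pi_iff.2 fun i : ι × κ => mX i.1 i.2)]
  rfl

namespace Network

variable {V J : Type*} [Fintype V] [DecidableEq V] [Fintype J] (N : Network V J)

theorem measurableSet_selection (s : Set (Selection V)) : MeasurableSet s :=
  MeasurableSpace.measurableSet_top

theorem setOf_walkLink_eq (j : J) (τ : ℕ) (ℓ : V × V) :
    {s | N.walkLink j s τ = some ℓ} =
      ⋃ v, {s | N.walkNode j s τ = some v} ∩ {s : ℕ → V → Selection V | s τ v = some ℓ} := by
  ext s
  simp [walkLink_eq_some_iff]

theorem setOf_walkNode_succ_eq (j : J) (τ : ℕ) (v : V) :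
    {s | N.walkNode j s (τ + 1) = some v} =
      ⋃ ℓ ∈ (Finset.univ.filter fun ℓ : V × V => ℓ.2 = v), {s | N.walkLink j s τ = some ℓ} := by
  ext s
  simp only [walkNode_succ, Set.mem_ofPred_eq, Option.map_eq_some_iff, Set.mem_iUnion,
    Finset.mem_filter, Finset.mem_univ, true_and, exists_prop]
  exact exists_congr fun ℓ => and_comm

theorem measurableSet_walkNode (j : J) (τ : ℕ) (v : V) :
    MeasurableSet {s | N.walkNode j s τ = some v} := by
  induction τ generalizing v with
  | zero =>
    simp only [walkNode]
    exact MeasurableSet.const _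
  | succ τ ih =>
    rw [setOf_walkNode_succ_eq]
    refine Finset.measurableSet_biUnion _ fun ℓ _ => ?_
    rw [setOf_walkLink_eq]
    refine MeasurableSet.iUnion fun v => (ih v).inter ?_
    have hm : Measurable fun s : ℕ → V → Selection V => s τ v := by fun_prop
    exact hm (measurableSet_selection {x | x = some ℓ})

theorem measurableSet_walkLink (j : J) (τ : ℕ) (ℓ : V × V) :
    MeasurableSet {s | N.walkLink j s τ = some ℓ} := by
  rw [setOf_walkLink_eq]
  refine MeasurableSet.iUnion fun v => (N.measurableSet_walkNode j τ v).inter ?_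
  have hm : Measurable fun s : ℕ → V → Selection V => s τ v := by fun_prop
  exact hm (measurableSet_selection {x | x = some ℓ})

theorem measurableSet_walkSet (j : J) (k : N.Route j) : MeasurableSet (N.walkSet j k) := by
  rw [walkSet, Set.ofPred_forall]
  exact MeasurableSet.iInter fun τ => N.measurableSet_walkLink j τ _

/-- Along a fixed route the node at each age is known in advance. The event therefore involves one
selection per age, and these are independent, which gives the product form of `routeProb`. -/
theorem walkSet_eq_iInter {j : J} {k : N.Route j} (hk : k ∈ N.routeSchedules j) :
    N.walkSet j k = ⋂ τ : Fin (N.deadline j + 1), {s | s τ (k τ).1 = some (k τ)} := by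
  simp only [routeSchedules, Finset.mem_filter] at hk
  obtain ⟨-, -, hk1, hk2, -⟩ := hk
  have key : ∀ (s : ℕ → V → Selection V) (τ : Fin (N.deadline j + 1)),
      (∀ i < τ, N.walkLink j s i = some (k i)) → N.walkNode j s τ = some (k τ).1 := by
    intro s τ
    refine Fin.cases ?_ (fun τ => ?_) τ
    · intro _
      rw [hk2]
      rfl
    · intro h
      have := h τ.castSucc Fin.castSucc_lt_succ
      rw [Fin.val_succ, walkNode_succ, ← Fin.val_castSucc, this, ← hk1]
      rfl
  ext s
  simp only [walkSet, Set.mem_ofPred_eq, Set.mem_iInter]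
  constructor
  · intro h τ
    rw [← h τ, N.walkLink_of_walkNode (key s τ fun i _ => h i)]
  · intro h τ
    induction τ using Fin.induction with
    | zero => rw [N.walkLink_of_walkNode (key s 0 fun i hi => absurd hi (Fin.not_lt_zero i)), h]
    | succ τ ih =>
      have h1 : N.walkNode j s (τ.succ : ℕ) = some (k τ.succ).1 := by
        rw [Fin.val_succ, walkNode_succ, ← Fin.val_castSucc, ih, ← hk1]
        rfl
      rw [N.walkLink_of_walkNode h1, h]

/-- The probability that a type-`j` packet walks along `k` if capacities are ignored. -/
def routeProb (f : Forwarding V J) (j : J) (k : N.Route j) : ℝ :=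
  ∏ τ : Fin (N.deadline j + 1), N.selectProb f j τ (k τ).1 (k τ)

section Selections

variable {Ω : Type*} [MeasurableSpace Ω] {P : Measure Ω} {f : Forwarding V J}
  {sel : Packet J → ℕ → V → Ω → Selection V}

theorem IsSelection.measurable_packet (hsel : N.IsSelection P f sel) (p : Packet J) :
    Measurable fun ω τ v => sel p τ v ω :=
  measurable_pi_iff.2 fun τ => measurable_pi_iff.2 fun v => hsel.measurable p τ v

theorem IsSelection.iIndepFun_packet (hsel : N.IsSelection P f sel) :
    iIndepFun (fun (p : Packet J) ω τ v => sel p τ v ω) P := by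
  have h := iIndepFun.rows (X := fun (p : Packet J) (i : ℕ × V) => sel p i.1 i.2)
    (fun p i => hsel.measurable p _ _) hsel.indep
  exact h.comp (fun _ (x : ℕ × V → Selection V) τ v => x (τ, v)) fun _ => by fun_prop

theorem IsSelection.iIndepFun_age (hsel : N.IsSelection P f sel) (p : Packet J) :
    iIndepFun (fun (τ : ℕ) ω v => sel p τ v ω) P :=
  iIndepFun.rows (X := fun (τ : ℕ) (v : V) => sel p τ v) (fun _ _ => hsel.measurable p _ _)
    (hsel.indep.precomp (g := fun i : ℕ × V => (p, i)) (Prod.mk_right_injective p))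

theorem IsSelection.prob_walkSet (hsel : N.IsSelection P f sel) (p : Packet J)
    {k : N.Route p.1} (hk : k ∈ N.routeSchedules p.1) :
    P.real {ω | (fun τ v => sel p τ v ω) ∈ N.walkSet p.1 k} = N.routeProb f p.1 k := by
  have h1 : iIndepFun (fun (τ : Fin (N.deadline p.1 + 1)) => sel p τ (k τ).1) P :=
    hsel.indep.precomp (g := fun τ : Fin (N.deadline p.1 + 1) => (p, (τ : ℕ), (k τ).1)) (by
      intro a b hab
      simp only [Prod.mk.injEq, true_and] at hab
      exact Fin.ext hab.1)
  have h2 := h1.meas_iInter 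
    (s := fun τ : Fin (N.deadline p.1 + 1) => {ω | sel p τ (k τ).1 ω = some (k τ)}) (fun τ =>
    ⟨{x | x = some (k τ)}, measurableSet_selection _, rfl⟩)
  have h3 : {ω | (fun τ v => sel p τ v ω) ∈ N.walkSet p.1 k} =
      ⋂ τ : Fin (N.deadline p.1 + 1), {ω | sel p τ (k τ).1 ω = some (k τ)} := by
    rw [walkSet_eq_iInter N hk]
    ext ω
    simp only [Set.mem_iInter]
    exact Iff.rfl
  rw [h3, Measure.real, h2, ENNReal.toReal_prod, routeProb]
  exact Finset.prod_congr rfl fun τ _ => hsel.prob p τ _ _ (Nat.lt_succ_iff.1 τ.2)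

/-- The position at age `τ` is a function of the selections at smaller ages, which are independent
of those at age `τ`. -/
theorem IsSelection.prob_walkNode_inter (hsel : N.IsSelection P f sel) (p : Packet J) (τ : ℕ)
    (hτ : τ ≤ N.deadline p.1) (v : V) (ℓ : V × V) :
    P.real ({ω | N.walkNode p.1 (fun τ v => sel p τ v ω) τ = some v} ∩
        {ω | sel p τ v ω = some ℓ}) =
      P.real {ω | N.walkNode p.1 (fun τ v => sel p τ v ω) τ = some v} *
        N.selectProb f p.1 τ v ℓ := by
  have h1 := (hsel.iIndepFun_age N p).indepFun_finset (Finset.range τ) {τ} (by simp)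
    (fun τ => measurable_pi_iff.2 fun v => hsel.measurable p τ v)
  obtain ⟨d⟩ : Nonempty (Selection V) := ⟨(none : Option (V × V))⟩
  -- Extends the selections before age `τ` by an arbitrary default, which the walk up to age `τ`
  -- never reads.
  let e : (Finset.range τ → V → Selection V) → ℕ → V → Selection V := fun x i v =>
    if h : i ∈ Finset.range τ then x ⟨i, h⟩ v else d
  have he : Measurable e := by
    refine measurable_pi_iff.2 fun i => measurable_pi_iff.2 fun v => ?_
    by_cases h : i ∈ Finset.range τ
    · simp only [e, dif_pos h]
      fun_prop
    · simp only [e, dif_neg h]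
      fun_prop
  have h2 : ∀ ω, N.walkNode p.1 (fun τ v => sel p τ v ω) τ =
      N.walkNode p.1 (e fun i v => sel p i v ω) τ := by
    intro ω
    refine N.walkNode_congr _ τ fun i hi v => ?_
    simp only [e, dif_pos (Finset.mem_range.2 hi)]
  have h3 := h1.measure_inter_preimage_eq_mul
    (e ⁻¹' {s | N.walkNode p.1 s τ = some v})
    {x | x ⟨τ, Finset.mem_singleton_self τ⟩ v = some ℓ}
    (he (N.measurableSet_walkNode p.1 τ v))
    (by
      have hm : Measurable fun x : ({τ} : Finset ℕ) → V → Selection V =>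
        x ⟨τ, Finset.mem_singleton_self τ⟩ v := by fun_prop
      exact hm (measurableSet_selection {x | x = some ℓ}))
  simp only [h2]
  rw [← hsel.prob p τ v ℓ hτ, Measure.real, Measure.real, Measure.real, ← ENNReal.toReal_mul]
  exact congrArg ENNReal.toReal h3

/-- Among the possible positions only the tail of `ℓ` contributes, since `selectProb` vanishes on
links that do not leave the current node. -/
theorem IsSelection.prob_walkLink_eq_sum [IsFiniteMeasure P] (hsel : N.IsSelection P f sel)
    (p : Packet J) (τ : ℕ) (hτ : τ ≤ N.deadline p.1) (ℓ : V × V) :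
    P.real {ω | N.walkLink p.1 (fun τ v => sel p τ v ω) τ = some ℓ} =
      P.real {ω | N.walkNode p.1 (fun τ v => sel p τ v ω) τ = some ℓ.1} *
        N.selectProb f p.1 τ ℓ.1 ℓ := by
  have h1 : {ω | N.walkLink p.1 (fun τ v => sel p τ v ω) τ = some ℓ} =
      ⋃ v, ({ω | N.walkNode p.1 (fun τ v => sel p τ v ω) τ = some v} ∩
        {ω | sel p τ v ω = some ℓ}) := by
    ext ω
    simp [walkLink_eq_some_iff]
  rw [h1, measureReal_iUnion_fintype]
  · rw [Finset.sum_eq_single ℓ.1]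
    · exact hsel.prob_walkNode_inter N p τ hτ _ _
    · intro v _ hv
      rw [hsel.prob_walkNode_inter N p τ hτ, selectProb, if_neg, mul_zero]
      simp only [outLinks, Finset.mem_filter, not_and]
      exact fun _ h => hv h.symm
    · simp
  · intro v w hvw
    refine Set.disjoint_left.2 fun ω hv hw => hvw ?_
    have := hv.1.symm.trans hw.1
    simpa using this
  · intro v
    exact (hsel.measurable_packet N p (N.measurableSet_walkNode p.1 τ v)).inter
      (hsel.measurable p τ v (measurableSet_selection {x | x = some ℓ}))

theorem IsSelection.prob_walkNode_succ [IsFiniteMeasure P] (hsel : N.IsSelection P f sel)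
    (p : Packet J) (τ : ℕ) (v : V) :
    P.real {ω | N.walkNode p.1 (fun τ v => sel p τ v ω) (τ + 1) = some v} =
      ∑ ℓ with ℓ.2 = v, P.real {ω | N.walkLink p.1 (fun τ v => sel p τ v ω) τ = some ℓ} := by
  have h1 : {ω | N.walkNode p.1 (fun τ v => sel p τ v ω) (τ + 1) = some v} =
      ⋃ ℓ ∈ (Finset.univ.filter fun ℓ : V × V => ℓ.2 = v),
        {ω | N.walkLink p.1 (fun τ v => sel p τ v ω) τ = some ℓ} := by
    have := congrArg (fun s => (fun ω τ v => sel p τ v ω) ⁻¹' s) (N.setOf_walkNode_succ_eq p.1 τ v)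
    simp only [Set.preimage_iUnion] at this
    exact this
  rw [h1, measureReal_biUnion_finset]
  · intro ℓ _ ℓ' _ hne
    refine Set.disjoint_left.2 fun ω hv hw => hne ?_
    have := (show _ = _ from hv).symm.trans hw
    simpa using this
  · intro ℓ _
    exact hsel.measurable_packet N p (N.measurableSet_walkLink p.1 τ ℓ)

theorem deadline_le_dmax (j : J) : N.deadline j ≤ N.dmax :=
  Finset.le_sup (f := N.deadline) (Finset.mem_univ j)

/-- Induction on the age: by conservation, the probability of being at a node equals the total flow
out of it, which cancels the denominator of `selectProb`. -/
theorem IsSelection.prob_walkLink [IsProbabilityMeasure P] {lam : J → ℝ} {ε : ℝ}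
    (hf : N.LPFeasible lam ε f) (hsel : N.IsSelection P f sel) (p : Packet J) (τ : ℕ)
    (hτ : τ ≤ N.deadline p.1) (ℓ : V × V) :
    P.real {ω | N.walkLink p.1 (fun τ v => sel p τ v ω) τ = some ℓ} =
      if ℓ ∈ N.allLinks then f p.1 ℓ τ else 0 := by
  induction τ generalizing ℓ with
  | zero =>
    rw [hsel.prob_walkLink_eq_sum N p 0 hτ]
    by_cases hℓ : ℓ ∈ N.allLinks
    · have h1 : ℓ ∈ N.outLinks ℓ.1 := by simp [outLinks, hℓ]
      rw [if_pos hℓ, selectProb, if_pos h1, if_pos rfl]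
      simp only [walkNode]
      by_cases hs : N.src p.1 = ℓ.1
      · simp [hs]
      · rw [hf.start p.1 ℓ hℓ, mul_zero]
        simp only [outLinks, Finset.mem_filter, not_and]
        exact fun _ h => hs h.symm
    · rw [if_neg hℓ, selectProb, if_neg, mul_zero]
      simp [outLinks, hℓ]
  | succ τ ih =>
    rw [hsel.prob_walkLink_eq_sum N p (τ + 1) hτ]
    by_cases hℓ : ℓ ∈ N.allLinks
    · have h1 : ℓ ∈ N.outLinks ℓ.1 := by simp [outLinks, hℓ]
      rw [if_pos hℓ, selectProb, if_pos h1, if_neg (Nat.succ_ne_zero τ)]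
      have h2 : P.real {ω | N.walkNode p.1 (fun τ v => sel p τ v ω) (τ + 1) = some ℓ.1} =
          ∑ ℓ' ∈ N.outLinks ℓ.1, f p.1 ℓ' (τ + 1) := by
        rw [hsel.prob_walkNode_succ N p τ ℓ.1,
          ← hf.conservation ℓ.1 p.1 (τ + 1) (Finset.mem_Icc.2 ⟨by omega, hτ⟩), inLinks]
        simp only [ih (by omega), Nat.add_sub_cancel]
        rw [← Finset.sum_filter, Finset.filter_comm]
        congr 1
        ext x
        simp
      rw [h2]
      -- At a node without outflow the quotient in `selectProb` is a default value, but
      -- nonnegativity forces the flow on each outgoing link to be zero as well.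
      rcases eq_or_ne (∑ ℓ' ∈ N.outLinks ℓ.1, f p.1 ℓ' (τ + 1)) 0 with h0 | h0
      · have h3 := (Finset.sum_eq_zero_iff_of_nonneg (fun ℓ' hℓ' => hf.nonneg p.1 ℓ'
          (Finset.mem_filter.1 hℓ').1 (τ + 1) (hτ.trans (N.deadline_le_dmax p.1)))).1 h0 ℓ h1
        rw [h0, h3, zero_mul]
      · rw [mul_div_cancel₀ _ h0]
    · rw [if_neg hℓ, selectProb, if_neg, mul_zero]
      simp [outLinks, hℓ]

/-- The LP flow of each type is conserved in total. -/
theorem LPFeasible.sum_allLinks {lam : J → ℝ} {ε : ℝ} (hf : N.LPFeasible lam ε f) (j : J) (τ : ℕ)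
    (hτ : τ ≤ N.deadline j) :
    ∑ ℓ ∈ N.allLinks, f j ℓ τ = ∑ ℓ ∈ N.outLinks (N.src j), f j ℓ 0 := by
  induction τ with
  | zero =>
    symm
    refine Finset.sum_subset (Finset.filter_subset _ _) fun ℓ hℓ hn => hf.start j ℓ hℓ hn
  | succ τ ih =>
    rw [← ih (by omega), ← Finset.sum_fiberwise N.allLinks (fun ℓ => ℓ.1),
      ← Finset.sum_fiberwise N.allLinks (fun ℓ => ℓ.2) (fun ℓ => f j ℓ τ)]
    exact Finset.sum_congr rfl fun v _ =>
      (hf.conservation v j (τ + 1) (Finset.mem_Icc.2 ⟨by omega, hτ⟩)).symm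

/-- A walk that still uses a link at age `d_j` is almost surely a route-schedule: links off the
graph are selected with probability zero, and `finish` kills the other end nodes. The probability of
surviving that long is the total flow at age `d_j`, which equals the total initial flow. -/
theorem IsSelection.le_sum_routeProb [IsProbabilityMeasure P] {lam : J → ℝ} {ε : ℝ}
    (hf : N.LPFeasible lam ε f) (hsel : N.IsSelection P f sel) (j : J) :
    ∑ ℓ ∈ N.outLinks (N.src j), f j ℓ 0 ≤ ∑ k ∈ N.routeSchedules j, N.routeProb f j k := by
  classical
  -- The law of a walk depends on the packet's type only, so any index of type `j` will do, even one
  -- that never arrives.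
  let p : Packet J := (j, 0, 0)
  have hnull : ∀ (τ : ℕ) (ℓ : V × V), P.real
      {ω | N.walkLink j (fun τ v => sel p τ v ω) τ = some ℓ} = 0 →
      ∀ᵐ ω ∂P, N.walkLink j (fun τ v => sel p τ v ω) τ ≠ some ℓ := by
    intro τ ℓ h
    rw [measureReal_eq_zero_iff] at h
    exact measure_eq_zero_iff_ae_notMem.1 h
  have hout : ∀ᵐ ω ∂P, ∀ τ : Fin (N.deadline j + 1), ∀ v, ∀ ℓ, ℓ ∉ N.outLinks v →
      sel p τ v ω ≠ some ℓ := by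
    refine ae_all_iff.2 fun τ => ae_all_iff.2 fun v => ae_all_iff.2 fun ℓ => ?_
    by_cases h : ℓ ∈ N.outLinks v
    · exact Filter.Eventually.of_forall fun _ hn => absurd h hn
    · have h0 := hsel.prob p τ v ℓ (Nat.lt_succ_iff.1 τ.2)
      rw [selectProb, if_neg h, measureReal_eq_zero_iff] at h0
      filter_upwards [measure_eq_zero_iff_ae_notMem.1 h0] with ω hω _ using hω
  have hdst : ∀ᵐ ω ∂P, ∀ ℓ, ℓ.2 ≠ N.dst j →
      N.walkLink j (fun τ v => sel p τ v ω) (N.deadline j) ≠ some ℓ := by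
    refine ae_all_iff.2 fun ℓ => ?_
    by_cases h : ℓ.2 = N.dst j
    · exact Filter.Eventually.of_forall fun _ hn => absurd h hn
    · have h0 := hsel.prob_walkLink N hf p (N.deadline j) le_rfl ℓ
      have h1 : (if ℓ ∈ N.allLinks then f p.1 ℓ (N.deadline j) else 0) = 0 := by
        split_ifs with hm
        · exact hf.finish j ℓ hm (by simp [inLinks, h])
        · rfl
      rw [h1] at h0
      filter_upwards [hnull _ ℓ h0] with ω hω _ using hω
  have hcover : ({ω | ∃ ℓ, N.walkLink j (fun τ v => sel p τ v ω) (N.deadline j) = some ℓ} : Set Ω)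
      ≤ᵐ[P] ⋃ k ∈ N.routeSchedules j, {ω | (fun τ v => sel p τ v ω) ∈ N.walkSet j k} := by
    filter_upwards [hout, hdst] with ω h1 h2 h3
    set s : ℕ → V → Selection V := fun τ v => sel p τ v ω
    obtain ⟨ℓ, hℓ⟩ : ∃ ℓ, N.walkLink j s (N.deadline j) = some ℓ := h3
    have hback : ∀ τ, (∃ ℓ, N.walkLink j s (τ + 1) = some ℓ) → ∃ ℓ, N.walkLink j s τ = some ℓ := by
      rintro τ ⟨ℓ, h⟩
      obtain ⟨v, hv, -⟩ := (N.walkLink_eq_some_iff).1 h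
      rw [walkNode_succ, Option.map_eq_some_iff] at hv
      exact ⟨_, hv.choose_spec.1⟩
    have hsome : ∀ i, i ≤ N.deadline j → ∃ ℓ, N.walkLink j s (N.deadline j - i) = some ℓ := by
      intro i hi
      induction i with
      | zero => exact ⟨ℓ, hℓ⟩
      | succ i ih =>
        apply hback
        rw [show N.deadline j - (i + 1) + 1 = N.deadline j - i by omega]
        exact ih (by omega)
    have hsome' : ∀ τ : Fin (N.deadline j + 1), ∃ ℓ, N.walkLink j s τ = some ℓ := by
      intro τ
      have := hsome (N.deadline j - τ) (by omega)
      rwa [show N.deadline j - (N.deadline j - (τ : ℕ)) = τ by omega] at this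
    choose k hk using hsome'
    have hnode : ∀ τ : Fin (N.deadline j + 1),
        k τ ∈ N.allLinks ∧ N.walkNode j s τ = some (k τ).1 := by
      intro τ
      obtain ⟨v, hv, hs⟩ := (N.walkLink_eq_some_iff).1 (hk τ)
      have hmem : k τ ∈ N.outLinks v := by
        by_contra hn
        exact h1 τ v _ hn hs
      rw [outLinks, Finset.mem_filter] at hmem
      exact ⟨hmem.1, by rw [hv, hmem.2]⟩
    refine Set.mem_iUnion₂.2 ⟨k, ?_, hk⟩
    rw [routeSchedules, Finset.mem_filter]
    refine ⟨Finset.mem_univ _, fun τ => (hnode τ).1, fun τ => ?_, ?_, ?_⟩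
    · have h4 := (hnode τ.succ).2
      rw [Fin.val_succ, walkNode_succ, ← Fin.val_castSucc, hk] at h4
      simpa using h4
    · have h4 := (hnode 0).2
      simp only [Fin.val_zero, walkNode, Option.some.injEq] at h4
      exact h4.symm
    · by_contra hn
      exact h2 _ hn (hk (Fin.last _))
  have hleft : P.real {ω | ∃ ℓ, N.walkLink j (fun τ v => sel p τ v ω) (N.deadline j) = some ℓ} =
      ∑ ℓ ∈ N.outLinks (N.src j), f j ℓ 0 := by
    rw [← hf.sum_allLinks N j (N.deadline j) le_rfl]
    have h1 : {ω | ∃ ℓ, N.walkLink j (fun τ v => sel p τ v ω) (N.deadline j) = some ℓ} =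
        ⋃ ℓ, {ω | N.walkLink j (fun τ v => sel p τ v ω) (N.deadline j) = some ℓ} := by
      ext ω
      simp
    rw [h1, measureReal_iUnion_fintype]
    · rw [Finset.sum_congr rfl fun ℓ _ => hsel.prob_walkLink N hf p (N.deadline j) le_rfl ℓ,
        ← Finset.sum_filter]
      congr 1
      ext x
      simp
    · intro ℓ ℓ' hne
      refine Set.disjoint_left.2 fun ω hv hw => hne ?_
      have := (show _ = _ from hv).symm.trans hw
      simpa using this
    · intro ℓ
      exact hsel.measurable_packet N p (N.measurableSet_walkLink j _ ℓ)
  rw [← hleft, ← Finset.sum_congr rfl fun k hk => hsel.prob_walkSet N p hk]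
  refine le_trans (ENNReal.toReal_mono (measure_ne_top _ _) (measure_mono_ae hcover)) ?_
  exact measureReal_biUnion_finset_le _ _

end Selections

end Network

/-! ### Chernoff bound for an overload, with the arrivals fixed. -/

namespace Network

variable {V J : Type*} [Fintype V] [DecidableEq V] [Fintype J] (N : Network V J)

/-- The LP flow over `ℓ` in slot `t` of a type-`j` packet that arrives in slot `τ`. -/
def flowAt (f : Forwarding V J) (ℓ : V × V) (t : ℕ) (j : J) (τ : ℕ) : ℝ :=
  if τ ≤ t ∧ t ≤ τ + N.deadline j then f j ℓ (t - τ) else 0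

variable {Ω : Type*} [MeasurableSpace Ω] {P : Measure Ω} {f : Forwarding V J}
  {sel : Packet J → ℕ → V → Ω → Selection V}

theorem IsSelection.prob_walkers [IsProbabilityMeasure P] {lam : J → ℝ} {ε : ℝ}
    (hf : N.LPFeasible lam ε f) (hsel : N.IsSelection P f sel) {ℓ : V × V}
    (hℓ : ℓ ∈ N.allLinks) (t : ℕ) (p : Packet J) :
    P.real {ω | p.2.1 ≤ t ∧ t ≤ p.2.1 + N.deadline p.1 ∧
      N.walkLink p.1 (fun τ v => sel p τ v ω) (t - p.2.1) = some ℓ} =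
      N.flowAt f ℓ t p.1 p.2.1 := by
  unfold flowAt
  split_ifs with h
  · have h1 := hsel.prob_walkLink N hf p (t - p.2.1) (by omega) ℓ
    rw [if_pos hℓ] at h1
    rw [← h1]
    congr 1
    ext ω
    exact ⟨fun hω => hω.2.2, fun hω => ⟨h.1, h.2, hω⟩⟩
  · rw [show {ω | p.2.1 ≤ t ∧ t ≤ p.2.1 + N.deadline p.1 ∧
      N.walkLink p.1 (fun τ v => sel p τ v ω) (t - p.2.1) = some ℓ} = ∅ from ?_, measureReal_empty]
    ext ω
    simp only [Set.mem_empty_iff_false, iff_false]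
    exact fun hω => h ⟨hω.1, hω.2.1⟩

theorem IsSelection.flowAt_mem_Icc [IsProbabilityMeasure P] {lam : J → ℝ} {ε : ℝ}
    (hf : N.LPFeasible lam ε f) (hsel : N.IsSelection P f sel) {ℓ : V × V}
    (hℓ : ℓ ∈ N.allLinks) (t : ℕ) (j : J) (τ : ℕ) :
    N.flowAt f ℓ t j τ ∈ Set.Icc 0 1 := by
  rw [← hsel.prob_walkers N hf hℓ t (j, τ, 0)]
  exact ⟨measureReal_nonneg, measureReal_le_one⟩

theorem routeProb_nonneg {lam : J → ℝ} {ε : ℝ} (hf : N.LPFeasible lam ε f) (j : J)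
    (k : N.Route j) : 0 ≤ N.routeProb f j k := by
  refine Finset.prod_nonneg fun τ _ => ?_
  have hτ : (τ : ℕ) ≤ N.dmax := (Nat.lt_succ_iff.1 τ.2).trans (N.deadline_le_dmax j)
  unfold selectProb
  split_ifs with h1 h2
  · exact hf.nonneg j _ (Finset.mem_filter.1 h1).1 0 (Nat.zero_le _)
  · exact div_nonneg (hf.nonneg j _ (Finset.mem_filter.1 h1).1 _ hτ)
      (Finset.sum_nonneg fun ℓ' hℓ' => hf.nonneg j _ (Finset.mem_filter.1 hℓ').1 _ hτ)
  · exact le_rfl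

theorem measurableSet_walkers (ℓ : V × V) (t : ℕ) (q : Packet J) :
    MeasurableSet {s : ℕ → V → Selection V | q.2.1 ≤ t ∧ t ≤ q.2.1 + N.deadline q.1 ∧
      N.walkLink q.1 s (t - q.2.1) = some ℓ} := by
  refine (MeasurableSet.const _).inter ((MeasurableSet.const _).inter ?_)
  exact N.measurableSet_walkLink q.1 _ ℓ

/-- For fixed arrivals, a Chernoff bound for the event that a given packet walks along a route and
finds one of its links overloaded. -/
theorem IsSelection.prob_overload_le [IsProbabilityMeasure P] {lam : J → ℝ} {ε : ℝ}
    (hf : N.LPFeasible lam ε f) (hsel : N.IsSelection P f sel) (T : ℕ) (A : J → ℕ → ℕ)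
    {p : Packet J} (hp : p ∈ arrivedPackets T A) {k : N.Route p.1}
    (hk : k ∈ N.routeSchedules p.1) (τ : Fin (N.deadline p.1 + 1)) (c : ℕ) {r : ℝ} (hr : 1 ≤ r) :
    P.real {ω | (fun τ v => sel p τ v ω) ∈ N.walkSet p.1 k ∧
        c < (N.walkers T A (fun q τ v => sel q τ v ω) (k τ) (p.2.1 + τ)).card} ≤
      N.routeProb f p.1 k * (r ^ c)⁻¹ * ∏ j, ∏ s ∈ Finset.Icc 1 T,
        (1 + N.flowAt f (k τ) (p.2.1 + τ) j s * (r - 1)) ^ A j s := by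
  classical
  set ℓ := k τ
  set t := p.2.1 + (τ : ℕ)
  have hℓ : ℓ ∈ N.allLinks := (Finset.mem_filter.1 hk).2.1 τ
  have hr0 : 0 < r := by linarith
  let B : Packet J → Set (ℕ → V → Selection V) := fun q =>
    {s | q.2.1 ≤ t ∧ t ≤ q.2.1 + N.deadline q.1 ∧ N.walkLink q.1 s (t - q.2.1) = some ℓ}
  have hB : ∀ q, MeasurableSet (B q) := fun q => N.measurableSet_walkers ℓ t q
  -- The packet `p` contributes the indicator of walking along `k`; every other packet contributes
  -- `r` if it walks over `ℓ` in slot `t` and `1` otherwise. The factors are functions of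
  -- independent selections.
  let g : Packet J → (ℕ → V → Selection V) → ℝ := fun q =>
    if h : q = p then (N.walkSet p.1 k).indicator 1 else fun s => 1 + (B q).indicator 1 s * (r - 1)
  have hgm : ∀ q, Measurable (g q) := by
    intro q
    by_cases h : q = p
    · simp only [g, dif_pos h]
      exact measurable_one.indicator (N.measurableSet_walkSet p.1 k)
    · simp only [g, dif_neg h]
      exact ((measurable_one.indicator (hB q)).mul_const _).const_add _
  have hgp : g p = (N.walkSet p.1 k).indicator 1 := by simp [g]
  have hgq : ∀ q ≠ p, g q = fun s => 1 + (B q).indicator 1 s * (r - 1) := by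
    intro q h
    simp [g, h]
  have hg1 : ∀ q ≠ p, ∀ s, 1 ≤ g q s := by
    intro q h s
    rw [hgq q h]
    have : 0 ≤ (B q).indicator (1 : (ℕ → V → Selection V) → ℝ) s :=
      Set.indicator_nonneg (fun _ _ => zero_le_one) s
    nlinarith
  have hg0 : ∀ q s, 0 ≤ g q s := by
    intro q s
    by_cases h : q = p
    · rw [h, hgp]
      exact Set.indicator_nonneg (fun _ _ => zero_le_one) s
    · exact zero_le_one.trans (hg1 q h s)
  set E : Set Ω := {ω | (fun τ v => sel p τ v ω) ∈ N.walkSet p.1 k ∧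
        c < (N.walkers T A (fun q τ v => sel q τ v ω) ℓ t).card} with hE
  have hEm : MeasurableSet E := by
    have h1 : Measurable fun ω => (N.walkers T A (fun q τ v => sel q τ v ω) ℓ t).card := by
      simp only [walkers, Finset.card_filter]
      refine Finset.measurable_sum _ fun q _ => ?_
      exact Measurable.ite (hsel.measurable_packet N q (hB q)) measurable_const measurable_const
    exact (hsel.measurable_packet N p (N.measurableSet_walkSet p.1 k)).inter
      (measurableSet_lt measurable_const h1)
  -- Markov's inequality, pointwise. On `E` the packet `p` is itself a walker, and the overload is
  -- strict, so at least `c` other walkers remain and their factors alone give `r ^ c`.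
  have hpt : ∀ ω, E.indicator (1 : Ω → ℝ) ω ≤
      (r ^ c)⁻¹ * ∏ q : arrivedPackets T A, g q (fun τ v => sel q τ v ω) := by
    intro ω
    have hnn : 0 ≤ (r ^ c)⁻¹ * ∏ q : arrivedPackets T A, g q (fun τ v => sel q τ v ω) :=
      mul_nonneg (by positivity) (Finset.prod_nonneg fun q _ => hg0 q _)
    by_cases hω : ω ∈ E
    · rw [Set.indicator_of_mem hω, Pi.one_apply]
      rw [← div_eq_inv_mul, one_le_div (by positivity)]
      rw [Finset.prod_coe_sort (arrivedPackets T A) fun q => g q (fun τ v => sel q τ v ω),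
        ← Finset.mul_prod_erase _ _ hp, hgp, Set.indicator_of_mem hω.1, Pi.one_apply, one_mul]
      set Wk := N.walkers T A (fun q τ v => sel q τ v ω) ℓ t
      have hpW : p ∈ Wk := by
        refine Finset.mem_filter.2 ⟨hp, by omega, by omega, ?_⟩
        have := hω.1 τ
        simp only at this ⊢
        rw [show t - p.2.1 = τ by omega]
        exact this
      have hsub : Wk.erase p ⊆ (arrivedPackets T A).erase p :=
        Finset.erase_subset_erase _ (Finset.filter_subset _ _)
      calc r ^ c ≤ r ^ (Wk.erase p).card := by
            refine pow_le_pow_right₀ hr ?_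
            have : c < Wk.card := hω.2
            rw [Finset.card_erase_of_mem hpW]
            omega
        _ = ∏ q ∈ Wk.erase p, r := by rw [Finset.prod_const]
        _ = ∏ q ∈ Wk.erase p, g q (fun τ v => sel q τ v ω) := by
            refine Finset.prod_congr rfl fun q hq => ?_
            rw [Finset.mem_erase] at hq
            have hqB : (fun τ v => sel q τ v ω) ∈ B q := (Finset.mem_filter.1 hq.2).2
            simp [hgq q hq.1, hqB]
        _ ≤ _ := Finset.prod_le_prod_of_subset_of_one_le hsub (fun q _ => hg0 q _)
            fun q hq _ => hg1 q (Finset.ne_of_mem_erase hq) _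
    · rw [Set.indicator_of_notMem hω]
      exact hnn
  have hgb : ∀ q s, g q s ≤ r := by
    intro q s
    by_cases h : q = p
    · rw [h, hgp]
      exact (Set.indicator_le_self' (fun _ _ => zero_le_one) s).trans hr
    · rw [hgq q h]
      have : (B q).indicator (1 : (ℕ → V → Selection V) → ℝ) s ≤ 1 :=
        Set.indicator_le_self' (fun _ _ => zero_le_one) s
      nlinarith
  have hprodm : Measurable fun ω => ∏ q : arrivedPackets T A, g q (fun τ v => sel q τ v ω) :=
    Finset.measurable_prod _ fun q _ => (hgm q).comp (hsel.measurable_packet N q)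
  have hint : Integrable (fun ω => ∏ q : arrivedPackets T A, g q (fun τ v => sel q τ v ω)) P := by
    refine Integrable.of_bound hprodm.aestronglyMeasurable
      (∏ q : arrivedPackets T A, r) (Filter.Eventually.of_forall fun ω => ?_)
    have h0 : 0 ≤ ∏ q : arrivedPackets T A, g q (fun τ v => sel q τ v ω) :=
      Finset.prod_nonneg fun q _ => hg0 q _
    rw [Real.norm_of_nonneg h0]
    exact Finset.prod_le_prod (fun q _ => hg0 q _) fun q _ => hgb q _
  have hindep : ∫ ω, ∏ q : arrivedPackets T A, g q (fun τ v => sel q τ v ω) ∂P =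
      ∏ q : arrivedPackets T A, ∫ ω, g q (fun τ v => sel q τ v ω) ∂P :=
    ((hsel.iIndepFun_packet N).precomp (g := fun q : arrivedPackets T A => (q : Packet J))
      Subtype.val_injective).integral_fun_prod_comp
      (fun q => (hsel.measurable_packet N q).aemeasurable)
      fun q => (hgm q).aestronglyMeasurable
  have hip : ∫ ω, g p (fun τ v => sel p τ v ω) ∂P = N.routeProb f p.1 k := by
    rw [hgp, ← hsel.prob_walkSet N p hk]
    exact integral_indicator_one
      (hsel.measurable_packet N p (N.measurableSet_walkSet p.1 k))
  have hiq : ∀ q ≠ p, ∫ ω, g q (fun τ v => sel q τ v ω) ∂P =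
      1 + N.flowAt f ℓ t q.1 q.2.1 * (r - 1) := by
    intro q h
    rw [hgq q h, ← hsel.prob_walkers N hf hℓ t q]
    have hm := hsel.measurable_packet N q (hB q)
    have h2 : Integrable (((fun ω τ v => sel q τ v ω) ⁻¹' B q).indicator (1 : Ω → ℝ)) P :=
      (integrable_const (1 : ℝ)).indicator hm
    have h3 := integral_indicator_one (μ := P) hm
    calc ∫ ω, (1 + (B q).indicator 1 (fun τ v => sel q τ v ω) * (r - 1)) ∂P
        = ∫ ω, (1 + ((fun ω τ v => sel q τ v ω) ⁻¹' B q).indicator 1 ω * (r - 1)) ∂P := rfl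
      _ = _ := by
        rw [integral_add (integrable_const _) (h2.mul_const _), integral_mul_const, h3]
        rw [integral_const, probReal_univ, one_smul]
        rfl
  calc P.real E = ∫ ω, E.indicator 1 ω ∂P := (integral_indicator_one hEm).symm
    _ ≤ ∫ ω, (r ^ c)⁻¹ * ∏ q : arrivedPackets T A, g q (fun τ v => sel q τ v ω) ∂P :=
        integral_mono ((integrable_const (1 : ℝ)).indicator hEm) (hint.const_mul _) hpt
    _ = (r ^ c)⁻¹ * ∏ q ∈ arrivedPackets T A, ∫ ω, g q (fun τ v => sel q τ v ω) ∂P := by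
        rw [integral_const_mul, hindep, Finset.prod_coe_sort (arrivedPackets T A)
          fun q => ∫ ω, g q (fun τ v => sel q τ v ω) ∂P]
    _ = (r ^ c)⁻¹ * (N.routeProb f p.1 k * ∏ q ∈ (arrivedPackets T A).erase p,
          (1 + N.flowAt f ℓ t q.1 q.2.1 * (r - 1))) := by
        rw [← Finset.mul_prod_erase _ _ hp, hip]
        congr 2
        exact Finset.prod_congr rfl fun q hq => hiq q (Finset.ne_of_mem_erase hq)
    -- Restoring a factor at least `1` for `p` makes the product depend on the arrivals only through
    -- their counts.
    _ ≤ (r ^ c)⁻¹ * (N.routeProb f p.1 k * ∏ q ∈ arrivedPackets T A,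
          (1 + N.flowAt f ℓ t q.1 q.2.1 * (r - 1))) := by
        have h1 : ∀ q : Packet J, 1 ≤ 1 + N.flowAt f ℓ t q.1 q.2.1 * (r - 1) := fun q => by
          have := (hsel.flowAt_mem_Icc N hf hℓ t q.1 q.2.1).1
          nlinarith
        refine mul_le_mul_of_nonneg_left (mul_le_mul_of_nonneg_left ?_ (N.routeProb_nonneg hf _ _))
          (by positivity)
        exact Finset.prod_le_prod_of_subset_of_one_le (Finset.erase_subset _ _)
          (fun q _ => zero_le_one.trans (h1 q)) fun q _ _ => h1 q
    _ = _ := by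
        rw [prod_arrivedPackets_const T A
          fun j s => 1 + N.flowAt f ℓ t j s * (r - 1)]
        ring

end Network

/-! ### Exponential moments of grouped arrivals. -/

/-- Convexity of the `D`-th power gives `(1 - q + q * r) ^ D ≤ 1 - q + q * r ^ D`. Weighted AM-GM
with weights `z s / D` then linearizes the product, so that its expectation involves only the
thinned mean of the group. -/
theorem prod_one_add_mul_pow_le {ι : Type*} [Fintype ι] {D : ℕ} (hD : 0 < D) {z : ι → ℕ}
    (hz : ∑ s, z s ≤ D) {q : ι → ℝ} (hq : ∀ s, q s ∈ Set.Icc 0 1) {r : ℝ} (hr : 1 ≤ r) :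
    ∏ s, (1 + q s * (r - 1)) ^ z s ≤ 1 + (r ^ D - 1) / D * ∑ s, q s * z s := by
  have hD' : (0 : ℝ) < D := Nat.cast_pos.2 hD
  have hz' : (∑ s, (z s : ℝ)) ≤ D := by exact_mod_cast hz
  have hrD : 1 ≤ r ^ D := one_le_pow₀ hr
  have hx : ∀ s, 0 ≤ 1 + q s * (r ^ D - 1) := fun s => by
    have := mul_nonneg (hq s).1 (sub_nonneg.2 hrD)
    linarith
  have hb : ∀ s, 0 ≤ 1 + q s * (r - 1) := fun s => by
    have := mul_nonneg (hq s).1 (sub_nonneg.2 hr)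
    linarith
  have hpow : ∀ s, (1 + q s * (r - 1)) ^ D ≤ 1 + q s * (r ^ D - 1) := fun s => by
    have h := (convexOn_pow D).2 (x := 1) (y := r) (Set.mem_Ici.2 zero_le_one)
      (Set.mem_Ici.2 (zero_le_one.trans hr)) (sub_nonneg.2 (hq s).2) (hq s).1 (by ring)
    simp only [smul_eq_mul, one_pow, mul_one] at h
    calc (1 + q s * (r - 1)) ^ D = (1 - q s + q s * r) ^ D := by ring
      _ ≤ 1 - q s + q s * r ^ D := h
      _ = _ := by ring
  have hterm : ∀ s, (1 + q s * (r - 1)) ^ z s ≤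
      (1 + q s * (r ^ D - 1)) ^ ((z s : ℝ) / D) := fun s => by
    calc (1 + q s * (r - 1)) ^ z s = ((1 + q s * (r - 1)) ^ D) ^ ((z s : ℝ) / D) := by
          rw [← Real.rpow_natCast _ D, ← Real.rpow_mul (hb s), mul_div_cancel₀ _ hD'.ne',
            Real.rpow_natCast]
      _ ≤ _ := Real.rpow_le_rpow (pow_nonneg (hb s) _) (hpow s) (by positivity)
  -- The extra index `none` carries the leftover weight `1 - (∑ s, z s) / D`, with value `1`.
  have hamgm := Real.geom_mean_le_arith_mean_weighted (Finset.univ : Finset (Option ι))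
    (fun o => o.elim (1 - (∑ s, (z s : ℝ)) / D) fun s => (z s : ℝ) / D)
    (fun o => o.elim 1 fun s => 1 + q s * (r ^ D - 1))
    (by
      rintro (_ | s) -
      · simp only [Option.elim_none, sub_nonneg]
        exact (div_le_one hD').2 hz'
      · simp only [Option.elim_some]
        positivity)
    (by
      rw [Fintype.sum_option]
      simp only [Option.elim_none, Option.elim_some, ← Finset.sum_div]
      ring)
    (by
      rintro (_ | s) -
      · simp
      · exact hx s)
  rw [Fintype.sum_option, Fintype.prod_option] at hamgm
  simp only [Option.elim_none, Option.elim_some, Real.one_rpow, one_mul, mul_one] at hamgm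
  calc ∏ s, (1 + q s * (r - 1)) ^ z s
      ≤ ∏ s, (1 + q s * (r ^ D - 1)) ^ ((z s : ℝ) / D) :=
        Finset.prod_le_prod (fun s _ => pow_nonneg (hb s) _) fun s _ => hterm s
    _ ≤ _ := hamgm
    _ = _ := by
      simp only [mul_add, mul_one, Finset.sum_add_distrib, Finset.mul_sum, Finset.sum_div]
      rw [← add_assoc, sub_add_cancel]
      congr 1
      refine Finset.sum_congr rfl fun s _ => ?_
      ring

/-- The crude bound, spent only on the single group that contains the size-biasing packet. -/
theorem prod_one_add_mul_pow_le_pow {ι : Type*} [Fintype ι] {D : ℕ} {z : ι → ℕ}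
    (hz : ∑ s, z s ≤ D) {q : ι → ℝ} (hq : ∀ s, q s ∈ Set.Icc 0 1) {r : ℝ} (hr : 1 ≤ r) :
    ∏ s, (1 + q s * (r - 1)) ^ z s ≤ r ^ D := by
  have hb : ∀ s, 0 ≤ q s * (r - 1) := fun s => mul_nonneg (hq s).1 (sub_nonneg.2 hr)
  calc ∏ s, (1 + q s * (r - 1)) ^ z s ≤ ∏ s, r ^ z s := by
        refine Finset.prod_le_prod (fun s _ => pow_nonneg (by linarith [hb s]) _) fun s _ =>
          pow_le_pow_left₀ (by linarith [hb s]) ?_ _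
        nlinarith [(hq s).2, (hq s).1]
    _ = r ^ ∑ s, z s := Finset.prod_pow_eq_pow_sum _ _ _
    _ ≤ r ^ D := pow_le_pow_right₀ hr hz

namespace DependencyDegreeLE

variable {Ω ι : Type*} [MeasurableSpace Ω] [Fintype ι] {P : Measure Ω} {X : ι → Ω → ℕ} {D : ℕ}

/-- There are finitely many groups of bounded size; this almost sure bound is the source of all
integrability of arrivals. -/
theorem exists_ae_le_mul (h : DependencyDegreeLE P X D) (hX : ∀ s, Measurable (X s)) :
    ∃ m : ℕ, ∀ᵐ ω ∂P, ∑ s, X s ω ≤ m * D := by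
  obtain ⟨m, ν, hν, hmap⟩ := h
  refine ⟨m, ?_⟩
  have hms : MeasurableSet {x : ι → ℕ | ∑ s, x s ≤ m * D} := (Set.to_countable _).measurableSet
  have h1 : ∀ᵐ x ∂(P.map fun ω s => X s ω), ∑ s, x s ≤ m * D := by
    rw [hmap, ae_map_iff (measurable_of_countable _).aemeasurable hms]
    have h2 : ∀ i, ∀ᵐ z ∂(Measure.pi fun i => (ν i : Measure (ι → ℕ))), ∑ s, z i s ≤ D := fun i =>
      (Measure.quasiMeasurePreserving_eval (fun i => (ν i : Measure (ι → ℕ))) i).ae (hν i)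
    filter_upwards [ae_all_iff.2 h2] with z hz
    rw [Finset.sum_comm]
    calc ∑ i, ∑ s, z i s ≤ ∑ _i : Fin m, D := Finset.sum_le_sum fun i _ => hz i
      _ = m * D := by simp
  exact (ae_map_iff (measurable_pi_iff.2 hX).aemeasurable hms).1 h1

/-- Moment bounds for counts with dependency degree `D`: thinned with probabilities `q s`, they
have the exponential moments of a Poisson number of groups of size `D`, also after size-biasing. -/
theorem moment_bounds [IsProbabilityMeasure P] (h : DependencyDegreeLE P X D)
    (hX : ∀ s, Measurable (X s)) (hD : 0 < D) {q : ι → ℝ} (hq : ∀ s, q s ∈ Set.Icc 0 1) {r : ℝ}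
    (hr : 1 ≤ r) :
    ∫ ω, ∏ s, (1 + q s * (r - 1)) ^ X s ω ∂P ≤
        Real.exp ((r ^ D - 1) / D * ∑ s, q s * ∫ ω, (X s ω : ℝ) ∂P) ∧
      ∀ s₀, ∫ ω, (X s₀ ω : ℝ) * ∏ s, (1 + q s * (r - 1)) ^ X s ω ∂P ≤
        (∫ ω, (X s₀ ω : ℝ) ∂P) * (r ^ D *
          Real.exp ((r ^ D - 1) / D * ∑ s, q s * ∫ ω, (X s ω : ℝ) ∂P)) := by
  classical
  obtain ⟨m, ν, hν, hmap⟩ := h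
  have hb : ∀ s, 1 ≤ 1 + q s * (r - 1) := fun s => by
    have := mul_nonneg (hq s).1 (sub_nonneg.2 hr)
    linarith
  have hrD : 1 ≤ r ^ D := one_le_pow₀ hr
  have hκ : 0 ≤ (r ^ D - 1) / D := div_nonneg (sub_nonneg.2 hrD) (Nat.cast_nonneg _)
  set κ := (r ^ D - 1) / D
  set μ := Measure.pi fun i => (ν i : Measure (ι → ℕ)) with hμ
  let g : (ι → ℕ) → ℝ := fun z => ∏ s, (1 + q s * (r - 1)) ^ z s
  have hg1 : ∀ z, 1 ≤ g z := fun z =>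
    Finset.prod_const_one.symm.trans_le (Finset.prod_le_prod (fun _ _ => zero_le_one)
      fun s _ => one_le_pow₀ (hb s))
  have hmeas : ∀ φ : (ι → ℕ) → ℝ, Measurable φ := fun φ => measurable_of_countable φ
  have hchange : ∀ φ : (ι → ℕ) → ℝ,
      ∫ ω, φ (fun s => X s ω) ∂P = ∫ z, φ (fun s => ∑ i, z i s) ∂μ := by
    intro φ
    rw [← integral_map (φ := fun ω s => X s ω) (measurable_pi_iff.2 hX).aemeasurable
      (hmeas φ).aestronglyMeasurable, hmap, integral_map (measurable_of_countable _).aemeasurable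
      (hmeas φ).aestronglyMeasurable]
  have hle : ∀ i, ∀ᵐ z ∂(ν i : Measure (ι → ℕ)), ∀ s, z s ≤ D := fun i => by
    filter_upwards [hν i] with z hz s
    exact (Finset.single_le_sum (f := z) (fun _ _ => Nat.zero_le _) (Finset.mem_univ s)).trans hz
  have hint : ∀ i, ∀ φ : (ι → ℕ) → ℝ, Integrable φ (ν i : Measure (ι → ℕ)) := by
    intro i φ
    have hfin : {z : ι → ℕ | z ≤ fun _ => D}.Finite := Set.finite_Iic _
    refine Integrable.of_bound (hmeas φ).aestronglyMeasurable (∑ z ∈ hfin.toFinset, ‖φ z‖) ?_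
    filter_upwards [hle i] with z hz
    exact Finset.single_le_sum (f := fun z => ‖φ z‖) (fun _ _ => norm_nonneg _)
      (hfin.mem_toFinset.2 hz)
  have hmean : ∀ s, ∫ ω, (X s ω : ℝ) ∂P = ∑ i, ∫ z, (z s : ℝ) ∂(ν i : Measure (ι → ℕ)) := by
    intro s
    rw [hchange fun x => (x s : ℝ)]
    push_cast
    have hi : ∀ i, MeasurePreserving (Function.eval i) μ (ν i : Measure (ι → ℕ)) := fun i =>
      measurePreserving_eval _ i
    rw [integral_finsetSum]
    · refine Finset.sum_congr rfl fun i _ => ?_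
      rw [← (hi i).map_eq, integral_map (hi i).measurable.aemeasurable
        (hmeas fun z => (z s : ℝ)).aestronglyMeasurable]
    · intro i _
      exact (hi i).integrable_comp_of_integrable (hint i fun z => (z s : ℝ))
  set Λ := ∑ s, q s * ∫ ω, (X s ω : ℝ) ∂P with hΛ
  let θ : Fin m → ℝ := fun i => ∑ s, q s * ∫ z, (z s : ℝ) ∂(ν i : Measure (ι → ℕ))
  have hΛθ : Λ = ∑ i, θ i := by
    simp only [hΛ, θ, hmean, Finset.mul_sum]
    exact Finset.sum_comm
  have hθ0 : ∀ i, 0 ≤ θ i := fun i => Finset.sum_nonneg fun s _ =>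
    mul_nonneg (hq s).1 (integral_nonneg fun z => Nat.cast_nonneg _)
  have hgi : ∀ i, ∫ z, g z ∂(ν i : Measure (ι → ℕ)) ≤ Real.exp (κ * θ i) := by
    intro i
    calc ∫ z, g z ∂(ν i : Measure (ι → ℕ))
        ≤ ∫ z, (1 + κ * ∑ s, q s * z s) ∂(ν i : Measure (ι → ℕ)) := by
          refine integral_mono_ae (hint i _) (hint i _) ?_
          filter_upwards [hν i] with z hz
          exact prod_one_add_mul_pow_le hD hz hq hr
      _ = 1 + κ * θ i := by
          rw [integral_add (hint i _) (hint i _), integral_const_mul, integral_finsetSum _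
            fun s _ => hint i _]
          simp only [integral_const_mul, θ, integral_const, probReal_univ, one_smul]
      _ ≤ _ := by
          rw [add_comm]
          exact Real.add_one_le_exp _
  have hgi1 : ∀ i, 1 ≤ ∫ z, g z ∂(ν i : Measure (ι → ℕ)) := fun i => by
    calc (1 : ℝ) = ∫ _z, (1 : ℝ) ∂(ν i : Measure (ι → ℕ)) := by simp
      _ ≤ _ := integral_mono (hint i _) (hint i _) hg1
  have hgsum : ∀ z : Fin m → ι → ℕ,
      ∏ s, (1 + q s * (r - 1)) ^ (∑ i, z i s) = ∏ i, g (z i) := by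
    intro z
    simp only [g, ← Finset.prod_pow_eq_pow_sum]
    exact Finset.prod_comm
  refine ⟨?_, fun s₀ => ?_⟩
  · calc ∫ ω, ∏ s, (1 + q s * (r - 1)) ^ X s ω ∂P
        = ∫ z, ∏ i, g (z i) ∂μ := by
          rw [hchange fun x => ∏ s, (1 + q s * (r - 1)) ^ x s]
          simp only [hgsum]
      _ = ∏ i, ∫ z, g z ∂(ν i : Measure (ι → ℕ)) := integral_fintype_prod_eq_prod fun _ => g
      _ ≤ ∏ i, Real.exp (κ * θ i) :=
          Finset.prod_le_prod (fun i _ => zero_le_one.trans (hgi1 i)) fun i _ => hgi i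
      _ = Real.exp (κ * Λ) := by rw [← Real.exp_sum, hΛθ, Finset.mul_sum]
  -- Split the count in slot `s₀` by groups. In the term of group `i` only the factor of that group
  -- is size-biased, and it costs `r ^ D`; the other groups keep their exponential bounds.
  · let G : Fin m → Fin m → (ι → ℕ) → ℝ := fun i i' z => if i' = i then z s₀ * g z else g z
    calc ∫ ω, (X s₀ ω : ℝ) * ∏ s, (1 + q s * (r - 1)) ^ X s ω ∂P
        = ∫ z, ∑ i, ∏ i', G i i' (z i') ∂μ := by
          rw [hchange fun x => (x s₀ : ℝ) * ∏ s, (1 + q s * (r - 1)) ^ x s]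
          simp only [hgsum]
          congr 1
          ext z
          push_cast
          rw [Finset.sum_mul]
          refine Finset.sum_congr rfl fun i _ => ?_
          rw [← Finset.mul_prod_erase _ _ (Finset.mem_univ i),
            ← Finset.mul_prod_erase _ (fun i' => G i i' (z i')) (Finset.mem_univ i), ← mul_assoc]
          simp only [G, if_true]
          congr 1
          exact Finset.prod_congr rfl fun i' hi' => by rw [if_neg (Finset.ne_of_mem_erase hi')]
      _ = ∑ i, ∏ i', ∫ z, G i i' z ∂(ν i' : Measure (ι → ℕ)) := by
          rw [integral_finsetSum]
          · exact Finset.sum_congr rfl fun i _ => integral_fintype_prod_eq_prod (G i)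
          · intro i _
            exact Integrable.fintype_prod_dep fun i' => hint i' _
      _ ≤ ∑ i, (∫ z, (z s₀ : ℝ) ∂(ν i : Measure (ι → ℕ))) * (r ^ D * Real.exp (κ * Λ)) := by
          refine Finset.sum_le_sum fun i _ => ?_
          rw [← Finset.mul_prod_erase _ _ (Finset.mem_univ i)]
          simp only [G, if_true]
          have h1 : ∏ i' ∈ Finset.univ.erase i, ∫ z, (if i' = i then z s₀ * g z else g z)
              ∂(ν i' : Measure (ι → ℕ)) ≤ Real.exp (κ * Λ) := by
            calc _ = ∏ i' ∈ Finset.univ.erase i, ∫ z, g z ∂(ν i' : Measure (ι → ℕ)) :=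
                  Finset.prod_congr rfl fun i' hi' => by
                    simp only [if_neg (Finset.ne_of_mem_erase hi')]
              _ ≤ ∏ i' ∈ Finset.univ.erase i, Real.exp (κ * θ i') :=
                  Finset.prod_le_prod (fun i _ => zero_le_one.trans (hgi1 i)) fun i _ => hgi i
              _ ≤ ∏ i', Real.exp (κ * θ i') :=
                  Finset.prod_le_prod_of_subset_of_one_le (Finset.erase_subset _ _)
                    (fun _ _ => (Real.exp_pos _).le)
                    fun i' _ _ => Real.one_le_exp (mul_nonneg hκ (hθ0 i'))
              _ = _ := by rw [← Real.exp_sum, hΛθ, Finset.mul_sum]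
          have h2 : ∫ z, (z s₀ : ℝ) * g z ∂(ν i : Measure (ι → ℕ)) ≤
              (∫ z, (z s₀ : ℝ) ∂(ν i : Measure (ι → ℕ))) * r ^ D := by
            rw [← integral_mul_const]
            refine integral_mono_ae (hint i _) (hint i _) ?_
            filter_upwards [hν i] with z hz
            exact mul_le_mul_of_nonneg_left (prod_one_add_mul_pow_le_pow hz hq hr)
              (Nat.cast_nonneg _)
          rw [← mul_assoc]
          refine mul_le_mul h2 h1 (Finset.prod_nonneg fun i' hi' => ?_)
            (mul_nonneg (integral_nonneg fun z => Nat.cast_nonneg _) (by positivity))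
          simp only [if_neg (Finset.ne_of_mem_erase hi')]
          exact zero_le_one.trans (hgi1 i')
      _ = _ := by rw [← Finset.sum_mul, hmean]

end DependencyDegreeLE

/-! ### The LP bound on the expected integer optimum. -/

namespace Network

variable {V J : Type*} [Fintype V] [DecidableEq V] [Fintype J] (N : Network V J)

theorem edgeAt_eq_some_iff {j : J} {k : N.Route j} (τ : Fin (N.deadline j + 1)) {ℓ : V × V} :
    N.edgeAt k τ = some ℓ ↔ k τ = ℓ := by
  rw [edgeAt, dif_pos τ.2, Option.some.injEq]

/-- Summing over arrival slots and ages is summing over transmission and arrival slots. -/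
theorem sum_age_eq_sum_window {M : Type*} [AddCommMonoid M] (T : ℕ) (h : ℕ → ℕ → M) :
    ∑ s ∈ Finset.Icc 1 T, ∑ τ ∈ Finset.range (N.dmax + 1), h s τ =
      ∑ t ∈ Finset.Icc 1 (T + N.dmax), ∑ s ∈ N.window T t, h s (t - s) := by
  rw [Finset.sum_sigma', Finset.sum_sigma']
  refine Finset.sum_bij' (fun x _ => ⟨x.1 + x.2, x.1⟩) (fun x _ => ⟨x.2, x.1 - x.2⟩) ?_ ?_ ?_ ?_ ?_
  · rintro ⟨s, τ⟩ hx
    simp only [Finset.mem_sigma, Finset.mem_Icc, Finset.mem_range, window] at hx ⊢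
    omega
  · rintro ⟨t, s⟩ hx
    simp only [Finset.mem_sigma, Finset.mem_Icc, Finset.mem_range, window] at hx ⊢
    omega
  · rintro ⟨s, τ⟩ hx
    simp
  · rintro ⟨t, s⟩ hx
    simp only [Finset.mem_sigma, Finset.mem_Icc, window] at hx
    simp only [Sigma.mk.injEq, heq_eq_eq, and_true]
    omega
  · rintro ⟨s, τ⟩ hx
    simp

/-- The amount routed over `ℓ` at age `τ` by the route weights `Y`. -/
def routeFlow (Y : (j : J) → N.Route j → ℝ) (j : J) (ℓ : V × V) (τ : ℕ) : ℝ :=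
  ∑ k ∈ N.routeSchedules j with N.edgeAt k τ = some ℓ, Y j k

theorem sum_routeFlow (Y : (j : J) → N.Route j → ℝ) (j : J) (τ : Fin (N.deadline j + 1))
    (s : Finset (V × V)) :
    ∑ ℓ ∈ s, N.routeFlow Y j ℓ τ = ∑ k ∈ N.routeSchedules j with k τ ∈ s, Y j k := by
  simp only [routeFlow, edgeAt_eq_some_iff, Finset.sum_filter]
  rw [Finset.sum_comm]
  refine Finset.sum_congr rfl fun k _ => ?_
  rw [Finset.sum_ite_eq]

/-- Route weights that respect the rates and the capacities give a feasible LP solution. -/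
theorem lpFeasible_of_routeWeights {lam : J → ℝ} {ε c : ℝ} (hε : 0 < ε) (hc : 0 < c)
    (hlam : ∀ j, 0 ≤ lam j) {Y : (j : J) → N.Route j → ℝ} (hY : ∀ j k, 0 ≤ Y j k)
    (hrate : ∀ j, ∑ k ∈ N.routeSchedules j, Y j k ≤ c * lam j)
    (hcap : ∀ ℓ ∈ N.links, ∑ j, ∑ τ ∈ Finset.range (N.deadline j + 1), N.routeFlow Y j ℓ τ ≤
      c * N.cap ℓ) :
    N.LPFeasible lam ε fun j ℓ τ => N.routeFlow Y j ℓ τ / (c * (1 + ε) * lam j) := by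
  have hflow : ∀ j ℓ τ, 0 ≤ N.routeFlow Y j ℓ τ := fun j ℓ τ =>
    Finset.sum_nonneg fun k _ => hY j k
  have hmem : ∀ {j} {k : N.Route j}, k ∈ N.routeSchedules j → (∀ τ, k τ ∈ N.allLinks) ∧
      (∀ τ : Fin (N.deadline j), (k τ.castSucc).2 = (k τ.succ).1) ∧
      (k 0).1 = N.src j ∧ (k (Fin.last _)).2 = N.dst j := fun hk => (Finset.mem_filter.1 hk).2
  -- Dividing by `c` turns totals over the horizon into rates per slot, by `lam j` into flows per
  -- packet, and by `1 + ε` meets the reduced LP capacity. Conservation holds route by route.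
  refine ⟨fun j => ?_, fun v j τ hτ => ?_, fun j ℓ _ hℓ => ?_, fun j ℓ _ hℓ => ?_,
    fun ℓ hℓ => ?_, fun j ℓ _ τ _ => ?_⟩
  · rw [← Finset.sum_div]
    have h1 := N.sum_routeFlow Y j 0 (N.outLinks (N.src j))
    rw [Fin.val_zero] at h1
    rw [h1]
    refine div_le_one_of_le₀ ?_ (mul_nonneg (by positivity) (hlam j))
    calc _ ≤ ∑ k ∈ N.routeSchedules j, Y j k :=
          Finset.sum_le_sum_of_subset_of_nonneg (Finset.filter_subset _ _) fun k _ _ => hY j k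
      _ ≤ c * lam j := hrate j
      _ ≤ _ := by nlinarith [mul_nonneg hc.le (hlam j)]
  · rw [← Finset.sum_div, ← Finset.sum_div]
    congr 1
    obtain ⟨hτ1, hτ2⟩ := Finset.mem_Icc.1 hτ
    obtain ⟨i, rfl⟩ : ∃ i : Fin (N.deadline j), τ = (i.succ : ℕ) := ⟨⟨τ - 1, by omega⟩, by
      simp only [Fin.val_succ]
      omega⟩
    have h1 := N.sum_routeFlow Y j i.castSucc (N.inLinks v)
    rw [show (i.succ : ℕ) - 1 = (i.castSucc : ℕ) by simp, h1, N.sum_routeFlow Y j i.succ]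
    congr 1
    refine Finset.filter_congr fun k hk => ?_
    simp only [inLinks, outLinks, Finset.mem_filter, (hmem hk).1, true_and, (hmem hk).2.1]
  · rw [routeFlow, Finset.filter_eq_empty_iff.2, Finset.sum_empty, zero_div]
    intro k hk h
    rw [← Fin.val_zero (N.deadline j + 1), edgeAt_eq_some_iff] at h
    subst h
    exact hℓ (Finset.mem_filter.2 ⟨(hmem hk).1 0, (hmem hk).2.2.1⟩)
  · rw [routeFlow, Finset.filter_eq_empty_iff.2, Finset.sum_empty, zero_div]
    intro k hk h
    rw [← Fin.val_last (N.deadline j), edgeAt_eq_some_iff] at h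
    subst h
    exact hℓ (Finset.mem_filter.2 ⟨(hmem hk).1 _, (hmem hk).2.2.2⟩)
  · calc ∑ j, ∑ τ ∈ Finset.range (N.deadline j + 1),
          lam j * (N.routeFlow Y j ℓ τ / (c * (1 + ε) * lam j))
        ≤ ∑ j, ∑ τ ∈ Finset.range (N.deadline j + 1), N.routeFlow Y j ℓ τ / (c * (1 + ε)) := by
          refine Finset.sum_le_sum fun j _ => Finset.sum_le_sum fun τ _ => ?_
          rcases (hlam j).eq_or_lt with h0 | h0
          · rw [← h0, zero_mul]
            exact div_nonneg (hflow j ℓ τ) (by positivity)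
          · refine le_of_eq ?_
            field_simp
      _ = (∑ j, ∑ τ ∈ Finset.range (N.deadline j + 1), N.routeFlow Y j ℓ τ) / (c * (1 + ε)) := by
          simp only [Finset.sum_div]
      _ ≤ c * N.cap ℓ / (c * (1 + ε)) := by
          have := hcap ℓ hℓ
          gcongr
      _ = _ := mul_div_mul_left _ _ hc.ne'
  · exact div_nonneg (hflow j ℓ τ) (mul_nonneg (by positivity) (hlam j))

theorem routeWeights_le_lpObjective {lam : J → ℝ} {ε c : ℝ} (hε : 0 < ε) (hc : 0 < c)
    (hlam : ∀ j, 0 ≤ lam j) {Y : (j : J) → N.Route j → ℝ} (hY : ∀ j k, 0 ≤ Y j k)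
    (hrate : ∀ j, ∑ k ∈ N.routeSchedules j, Y j k ≤ c * lam j)
    (hcap : ∀ ℓ ∈ N.links, ∑ j, ∑ τ ∈ Finset.range (N.deadline j + 1), N.routeFlow Y j ℓ τ ≤
      c * N.cap ℓ) {f : Forwarding V J} (hf : N.LPOptimal lam ε f) :
    ∑ j, N.weight j * ∑ k ∈ N.routeSchedules j, Y j k ≤ c * (1 + ε) * N.lpObjective lam f := by
  refine le_trans (le_of_eq ?_) (mul_le_mul_of_nonneg_left
    (hf.2 _ (N.lpFeasible_of_routeWeights hε hc hlam hY hrate hcap)) (by positivity))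
  rw [lpObjective, Finset.mul_sum]
  refine Finset.sum_congr rfl fun j _ => ?_
  have h1 := N.sum_routeFlow Y j 0 (N.outLinks (N.src j))
  have h2 : (N.routeSchedules j).filter (fun k => k 0 ∈ N.outLinks (N.src j)) =
      N.routeSchedules j := by
    refine Finset.filter_true_of_mem fun k hk => ?_
    have h := (Finset.mem_filter.1 hk).2
    exact Finset.mem_filter.2 ⟨h.1 0, h.2.2.1⟩
  rw [Fin.val_zero, h2] at h1
  rw [← Finset.sum_div, h1]
  -- If the rate is zero, the division by it loses the weight of `Y`, but then `hrate` forces that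
  -- weight to be zero.
  rcases (hlam j).eq_or_lt with h0 | h0
  · have h3 : ∑ k ∈ N.routeSchedules j, Y j k = 0 := by
      refine le_antisymm ?_ (Finset.sum_nonneg fun k _ => hY j k)
      have := hrate j
      rwa [← h0, mul_zero] at this
    rw [h3]
    simp
  · field_simp

section Benchmark

variable {T : ℕ} {A : J → ℕ → ℕ} {y : N.Decisions}

/-- The number of type-`j` packets scheduled over `k` by `y`. -/
def routeCount (T : ℕ) (A : J → ℕ → ℕ) (y : N.Decisions) (j : J) (k : N.Route j) : ℝ :=
  ∑ t ∈ Finset.Icc 1 T, ∑ n ∈ Finset.Icc 1 (A j t), (y j t n k : ℝ)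

theorem routeCount_nonneg (j : J) (k : N.Route j) : 0 ≤ N.routeCount T A y j k :=
  Finset.sum_nonneg fun _ _ => Finset.sum_nonneg fun _ _ => Nat.cast_nonneg _

theorem reward_eq_sum_routeCount :
    N.reward T A y = ∑ j, N.weight j * ∑ k ∈ N.routeSchedules j, N.routeCount T A y j k := by
  rw [reward, Finset.sum_comm]
  refine Finset.sum_congr rfl fun j _ => ?_
  rw [← Finset.mul_sum]
  congr 1
  simp only [routeCount]
  rw [Finset.sum_comm (s := N.routeSchedules j)]
  exact Finset.sum_congr rfl fun t _ => Finset.sum_comm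

theorem RIFeasible.sum_routeCount_le (hy : N.RIFeasible T A y) (j : J) :
    ∑ k ∈ N.routeSchedules j, N.routeCount T A y j k ≤ ∑ t ∈ Finset.Icc 1 T, (A j t : ℝ) := by
  simp only [routeCount]
  rw [Finset.sum_comm]
  refine Finset.sum_le_sum fun t ht => ?_
  rw [Finset.sum_comm]
  calc _ ≤ ∑ n ∈ Finset.Icc 1 (A j t), (1 : ℝ) :=
        Finset.sum_le_sum fun n hn => by exact_mod_cast hy.one_choice t ht j n hn
    _ = A j t := by simp

/-- Sums the slot capacities over the whole period in which packets may move. Late packets travel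
after slot `T`, which is why the factor is `T + dmax`. -/
theorem RIFeasible.sum_routeFlow_le (hy : N.RIFeasible T A y) {ℓ : V × V} (hℓ : ℓ ∈ N.links) :
    ∑ j, ∑ τ ∈ Finset.range (N.deadline j + 1), N.routeFlow (N.routeCount T A y) j ℓ τ ≤
      (T + N.dmax) * N.cap ℓ := by
  let h : ℕ → ℕ → ℝ := fun s τ => ∑ j, ∑ n ∈ Finset.Icc 1 (A j s),
    ∑ k ∈ (N.routeSchedules j).filter (fun k => N.edgeAt k τ = some ℓ), (y j s n k : ℝ)
  calc ∑ j, ∑ τ ∈ Finset.range (N.deadline j + 1), N.routeFlow (N.routeCount T A y) j ℓ τ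
      ≤ ∑ j, ∑ τ ∈ Finset.range (N.dmax + 1), N.routeFlow (N.routeCount T A y) j ℓ τ := by
        refine Finset.sum_le_sum fun j _ => Finset.sum_le_sum_of_subset_of_nonneg ?_ ?_
        · exact Finset.range_mono (Nat.succ_le_succ (N.deadline_le_dmax j))
        · exact fun τ _ _ => Finset.sum_nonneg fun k _ => N.routeCount_nonneg j k
    _ = ∑ s ∈ Finset.Icc 1 T, ∑ τ ∈ Finset.range (N.dmax + 1), h s τ := by
        simp only [h, routeFlow, routeCount]
        rw [Finset.sum_comm, Finset.sum_comm (s := Finset.Icc 1 T)]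
        refine Finset.sum_congr rfl fun τ _ => ?_
        rw [Finset.sum_comm (s := Finset.Icc 1 T)]
        refine Finset.sum_congr rfl fun j _ => ?_
        rw [Finset.sum_comm]
        exact Finset.sum_congr rfl fun s _ => Finset.sum_comm
    _ = ∑ t ∈ Finset.Icc 1 (T + N.dmax), ∑ s ∈ N.window T t, h s (t - s) :=
        N.sum_age_eq_sum_window T h
    _ ≤ ∑ t ∈ Finset.Icc 1 (T + N.dmax), (N.cap ℓ : ℝ) := by
        refine Finset.sum_le_sum fun t ht => ?_
        simp only [h]
        exact_mod_cast hy.capacity ℓ hℓ t ht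
    _ = _ := by simp

/-- The expected optimum of the random integer problem is at most the LP optimum, up to the
LP's capacity scaling and boundary effects. -/
theorem integral_optRI_le {Ω : Type*} [MeasurableSpace Ω] {P : Measure Ω} [IsProbabilityMeasure P]
    {a : J → ℕ → Ω → ℕ} {lam : J → ℝ} {ε : ℝ} (hε : 0 < ε) (hT : 0 < T)
    (hint : ∀ φ : (J → Finset.Icc 1 T → ℕ) → ℝ, Integrable (fun ω => φ fun j t => a j t ω) P)
    (ha_rate : ∀ j, ∀ t ∈ Finset.Icc 1 T, ∫ ω, (a j t ω : ℝ) ∂P = lam j)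
    {f : Forwarding V J} (hf : N.LPOptimal lam ε f) :
    ∫ ω, N.optRI T (fun j t => a j t ω) ∂P ≤
      (T + N.dmax) * (1 + ε) * N.lpObjective lam f := by
  choose y hy hopt using fun α : J → Finset.Icc 1 T → ℕ =>
    N.exists_reward_eq_optRI T (truncateArrivals T α)
  let m : (j : J) → N.Route j → (J → Finset.Icc 1 T → ℕ) → ℝ := fun j k α =>
    N.routeCount T (truncateArrivals T α) (y α) j k
  -- Expected route counts of a chosen optimal solution. The constraints pass to expectations by
  -- linearity, and the choice needs no measurable selection because the truncated arrivals are
  -- countable.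
  let Y : (j : J) → N.Route j → ℝ := fun j k => ∫ ω, m j k (fun j t => a j t ω) ∂P
  have hlam : ∀ j, 0 ≤ lam j := fun j => by
    rw [← ha_rate j 1 (Finset.mem_Icc.2 ⟨le_rfl, hT⟩)]
    exact integral_nonneg fun ω => Nat.cast_nonneg _
  have hTd : (0 : ℝ) < T + N.dmax := by positivity
  have hval : ∫ ω, N.optRI T (fun j t => a j t ω) ∂P =
      ∑ j, N.weight j * ∑ k ∈ N.routeSchedules j, Y j k := by
    have h1 : ∀ ω, N.optRI T (fun j t => a j t ω) =
        ∑ j, N.weight j * ∑ k ∈ N.routeSchedules j, m j k (fun j t => a j t ω) := by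
      intro ω
      rw [← N.optRI_congr (truncateArrivals_restrict fun j t => a j t ω), hopt,
        reward_eq_sum_routeCount]
    simp only [h1]
    rw [integral_finsetSum]
    · refine Finset.sum_congr rfl fun j _ => ?_
      rw [integral_const_mul, integral_finsetSum]
      exact fun k _ => hint (m j k)
    · exact fun j _ => hint fun α => N.weight j * ∑ k ∈ N.routeSchedules j, m j k α
  rw [hval]
  refine N.routeWeights_le_lpObjective (Y := Y) hε hTd hlam
    (fun j k => integral_nonneg fun ω => N.routeCount_nonneg j k) (fun j => ?_) (fun ℓ hℓ => ?_) hf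
  · calc ∑ k ∈ N.routeSchedules j, Y j k
        = ∫ ω, ∑ k ∈ N.routeSchedules j, m j k (fun j t => a j t ω) ∂P :=
          (integral_finsetSum _ fun k _ => hint (m j k)).symm
      _ ≤ ∫ ω, ∑ t ∈ Finset.Icc 1 T, (a j t ω : ℝ) ∂P := by
          refine integral_mono (hint fun α => ∑ k ∈ N.routeSchedules j, m j k α) ?_ fun ω => ?_
          · refine integrable_finsetSum _ fun t ht => ?_
            exact hint fun α => (α j ⟨t, ht⟩ : ℝ)
          · refine ((hy fun j t => a j t ω).sum_routeCount_le N j).trans (le_of_eq ?_)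
            exact Finset.sum_congr rfl fun t ht => by
              rw [truncateArrivals_restrict (fun j t => a j t ω) j t ht]
      _ = ∑ t ∈ Finset.Icc 1 T, lam j := by
          rw [integral_finsetSum]
          · exact Finset.sum_congr rfl fun t ht => ha_rate j t ht
          · exact fun t ht => hint fun α => (α j ⟨t, ht⟩ : ℝ)
      _ = T * lam j := by simp
      _ ≤ (T + N.dmax) * lam j :=
          mul_le_mul_of_nonneg_right (le_add_of_nonneg_right (Nat.cast_nonneg _)) (hlam j)
  · have h1 : ∀ j τ, N.routeFlow Y j ℓ τ =
        ∫ ω, N.routeFlow (fun j k => m j k fun j t => a j t ω) j ℓ τ ∂P := fun j τ =>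
      (integral_finsetSum _ fun k _ => hint (m j k)).symm
    have h2 : ∀ j τ, Integrable
        (fun ω => N.routeFlow (fun j k => m j k fun j t => a j t ω) j ℓ τ) P := fun j τ =>
      hint fun α => N.routeFlow (fun j k => m j k α) j ℓ τ
    simp only [h1]
    rw [← Finset.sum_congr rfl fun j _ => integral_finsetSum _ fun τ _ => h2 j τ,
      ← integral_finsetSum _ fun j _ => integrable_finsetSum _ fun τ _ => h2 j τ]
    calc _ ≤ ∫ _ω, ((T + N.dmax) * N.cap ℓ : ℝ) ∂P := by
          refine integral_mono ?_ (integrable_const _) fun ω =>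
            (hy fun j t => a j t ω).sum_routeFlow_le N hℓ
          exact integrable_finsetSum _ fun j _ => integrable_finsetSum _ fun τ _ => h2 j τ
      _ = _ := by simp

end Benchmark

end Network

/-! ### The tail of a link's load under random arrivals. -/

/-- The Chernoff exponent for links of capacity `C` loaded to `C / (1 + ε)` by groups of size `D`. -/
theorem chernoff_factor_le {D C : ℕ} (hD : 0 < D) {ε x : ℝ} (hε : 0 < ε) (hx : 0 < x)
    (hC : 2 * (D : ℝ) * ((1 + ε) / ε) ^ 2 * Real.log (x / ε) ≤ C) {r : ℝ} (hr : 0 < r)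
    (hrD : r ^ D = 1 + ε) {Λ : ℝ} (hΛ : Λ ≤ C / (1 + ε)) :
    (r ^ C)⁻¹ * (r ^ D * Real.exp ((r ^ D - 1) / D * Λ)) ≤ (1 + ε) * (ε / x) := by
  have hD' : (0 : ℝ) < D := Nat.cast_pos.2 hD
  have h1 : (0 : ℝ) < 1 + ε := by linarith
  have hlog : Real.log r = Real.log (1 + ε) / D := by
    rw [← hrD, Real.log_pow]
    field_simp
  have hrC : (r ^ C)⁻¹ = Real.exp (-(C * (Real.log (1 + ε) / D))) := by
    rw [Real.exp_neg, ← hlog, ← Real.log_pow, Real.exp_log (pow_pos hr _)]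
  -- From `log (1 + ε) ≥ 2 * ε / (ε + 2)`. The quadratic gain is the net exponent per unit of `C /
  -- D`, and its inverse is the constant `2 * ((1 + ε) / ε) ^ 2` of the capacity condition.
  have hquad : ε / (1 + ε) + (ε / (1 + ε)) ^ 2 / 2 ≤ Real.log (1 + ε) := by
    refine le_trans ?_ (Real.le_log_one_add_of_nonneg hε.le)
    rw [div_pow, div_div, div_add_div _ _ (by positivity) (by positivity),
      div_le_div_iff₀ (by positivity) (by positivity), ← sub_nonneg]
    have : 0 ≤ ε ^ 3 * (1 + ε) := by positivity
    linear_combination this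
  have hexp : ε / D * (C / (1 + ε)) - C * (Real.log (1 + ε) / D) ≤ -Real.log (x / ε) := by
    have h3 : Real.log (x / ε) ≤ C / D * ((ε / (1 + ε)) ^ 2 / 2) := by
      calc Real.log (x / ε)
          = (2 * (D : ℝ) * ((1 + ε) / ε) ^ 2 * Real.log (x / ε)) / D *
              ((ε / (1 + ε)) ^ 2 / 2) := by field_simp
        _ ≤ _ := by gcongr
    have h4 : C / D * (ε / (1 + ε) + (ε / (1 + ε)) ^ 2 / 2) ≤ C / D * Real.log (1 + ε) :=
      mul_le_mul_of_nonneg_left hquad (by positivity)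
    have h5 : ε / D * (C / (1 + ε)) = C / D * (ε / (1 + ε)) := by field_simp
    have h6 : C * (Real.log (1 + ε) / D) = C / D * Real.log (1 + ε) := by field_simp
    rw [h5, h6]
    linarith
  rw [hrD, hrC, add_sub_cancel_left, mul_left_comm, ← Real.exp_add]
  refine mul_le_mul_of_nonneg_left ?_ h1.le
  calc Real.exp (-(C * (Real.log (1 + ε) / D)) + ε / D * Λ)
      ≤ Real.exp (-Real.log (x / ε)) := by
        refine Real.exp_le_exp.2 ?_
        have : ε / D * Λ ≤ ε / D * (C / (1 + ε)) :=
          mul_le_mul_of_nonneg_left hΛ (by positivity)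
        linarith
    _ = ε / x := by rw [Real.exp_neg, Real.exp_log (by positivity), inv_div]

namespace Network

variable {V J : Type*} [Fintype V] [DecidableEq V] [Fintype J] (N : Network V J)

theorem flowAt_eq_zero {f : Forwarding V J} {ℓ : V × V} {T t : ℕ} {j : J} {s : ℕ}
    (hs : s ∈ Finset.Icc 1 T) (hsw : s ∉ N.window T t) : N.flowAt f ℓ t j s = 0 := by
  rw [flowAt, if_neg]
  rintro ⟨h1, h2⟩
  have := N.deadline_le_dmax j
  simp only [window, Finset.mem_Icc] at hs hsw
  omega

theorem window_subset (T t : ℕ) : N.window T t ⊆ Finset.Icc 1 T := by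
  intro s hs
  simp only [window, Finset.mem_Icc] at hs ⊢
  omega

/-- For a fixed slot `t`, distinct arrival slots have distinct ages `t - s`, so the expected load is
a partial sum of the LP capacity constraint. -/
theorem LPFeasible.sum_flowAt_le {lam : J → ℝ} {ε : ℝ} {f : Forwarding V J}
    (hf : N.LPFeasible lam ε f) (hlam : ∀ j, 0 ≤ lam j) {ℓ : V × V} (hℓ : ℓ ∈ N.links)
    (T t : ℕ) :
    ∑ j, ∑ s ∈ N.window T t, N.flowAt f ℓ t j s * lam j ≤ (N.cap ℓ : ℝ) / (1 + ε) := by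
  refine le_trans (Finset.sum_le_sum fun j _ => ?_) (hf.capacity ℓ hℓ)
  have hall : ℓ ∈ N.allLinks := Finset.mem_union_left _ hℓ
  calc ∑ s ∈ N.window T t, N.flowAt f ℓ t j s * lam j
      = ∑ s ∈ (N.window T t).filter (fun s => s ≤ t ∧ t ≤ s + N.deadline j),
          lam j * f j ℓ (t - s) := by
        rw [Finset.sum_filter]
        refine Finset.sum_congr rfl fun s _ => ?_
        rw [flowAt]
        split_ifs <;> ring
    _ = ∑ τ ∈ ((N.window T t).filter (fun s => s ≤ t ∧ t ≤ s + N.deadline j)).image (t - ·),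
          lam j * f j ℓ τ := by
        rw [Finset.sum_image]
        intro s hs s' hs' h
        simp only [Finset.coe_filter, Set.mem_ofPred_eq] at hs hs' h
        omega
    _ ≤ _ := by
        refine Finset.sum_le_sum_of_subset_of_nonneg ?_ fun τ hτ _ => ?_
        · intro τ hτ
          simp only [Finset.mem_image, Finset.mem_filter] at hτ
          obtain ⟨s, hs, rfl⟩ := hτ
          rw [Finset.mem_range]
          omega
        · exact mul_nonneg (hlam j) (hf.nonneg j ℓ hall τ
            ((Nat.lt_succ_iff.1 (Finset.mem_range.1 hτ)).trans (N.deadline_le_dmax j)))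

variable {Ω : Type*} [MeasurableSpace Ω] {P : Measure Ω}

/-- The size-biased exponential moment of the load of a link. -/
theorem integral_mul_prod_pow_le [IsProbabilityMeasure P] {T D : ℕ} (hD : 0 < D)
    {a : J → ℕ → Ω → ℕ} {lam : J → ℝ}
    (ha_meas : ∀ j t, Measurable (a j t))
    (ha_rate : ∀ j, ∀ t ∈ Finset.Icc 1 T, ∫ ω, (a j t ω : ℝ) ∂P = lam j)
    (ha_types : iIndepFun (fun j ω t => a j t ω) P)
    {t : ℕ} (ha_dep : ∀ j, DependencyDegreeLE P (fun (s : N.window T t) => a j s) D)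
    {q : J → ℕ → ℝ} (hq : ∀ j s, q j s ∈ Set.Icc 0 1)
    (hq0 : ∀ j, ∀ s ∈ Finset.Icc 1 T, s ∉ N.window T t → q j s = 0) {r : ℝ} (hr : 1 ≤ r)
    (j₀ : J) {s₀ : ℕ} (hs₀ : s₀ ∈ N.window T t) :
    ∫ ω, (a j₀ s₀ ω : ℝ) * ∏ j, ∏ s ∈ Finset.Icc 1 T, (1 + q j s * (r - 1)) ^ a j s ω ∂P ≤
      lam j₀ * (r ^ D *
        Real.exp ((r ^ D - 1) / D * ∑ j, ∑ s ∈ N.window T t, q j s * lam j)) := by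
  classical
  have hmom := fun j => (ha_dep j).moment_bounds (fun s => ha_meas j s) hD
    (q := fun s : N.window T t => q j s) (fun s => hq j s) hr
  have hrate : ∀ j (s : N.window T t), ∫ ω, (a j s ω : ℝ) ∂P = lam j := fun j s =>
    ha_rate j s (N.window_subset T t s.2)
  simp only [hrate] at hmom
  set κ := (r ^ D - 1) / D
  have hb : ∀ j s, 0 ≤ 1 + q j s * (r - 1) := fun j s => by
    have := mul_nonneg (hq j s).1 (sub_nonneg.2 hr)
    linarith
  have hwin : ∀ j (x : ℕ → ℕ), ∏ s ∈ Finset.Icc 1 T, (1 + q j s * (r - 1)) ^ x s =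
      ∏ s : N.window T t, (1 + q j s * (r - 1)) ^ x s := by
    intro j x
    rw [Finset.prod_coe_sort (N.window T t) fun s => (1 + q j s * (r - 1)) ^ x s]
    symm
    refine Finset.prod_subset (N.window_subset T t) fun s hs hsw => ?_
    rw [hq0 j s hs hsw, zero_mul, add_zero, one_pow]
  -- One factor per type, to be integrated separately by independence of the types; only type `j₀`
  -- carries the size-biasing count.
  let φ : J → (ℕ → ℕ) → ℝ := fun j x =>
    (if j = j₀ then (x s₀ : ℝ) else 1) * ∏ s : N.window T t, (1 + q j s * (r - 1)) ^ x s
  have hφm : ∀ j, Measurable (φ j) := by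
    intro j
    refine Measurable.mul ?_ (Finset.measurable_prod _ fun s _ => ?_)
    · split_ifs
      · have h : Measurable fun x : ℕ → ℕ => x s₀ := measurable_pi_apply _
        exact (measurable_of_countable fun n : ℕ => (n : ℝ)).comp h
      · exact measurable_const
    · have h : Measurable fun x : ℕ → ℕ => x s := measurable_pi_apply _
      exact (measurable_of_countable fun n : ℕ => (1 + q j s * (r - 1)) ^ n).comp h
  have hpt : ∀ ω, (a j₀ s₀ ω : ℝ) *
      ∏ j, ∏ s ∈ Finset.Icc 1 T, (1 + q j s * (r - 1)) ^ a j s ω =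
      ∏ j, φ j (fun t => a j t ω) := by
    intro ω
    simp only [φ, Finset.prod_mul_distrib, Finset.prod_ite_eq', Finset.mem_univ, if_true]
    congr 1
    exact Finset.prod_congr rfl fun j _ => hwin j fun s => a j s ω
  have hmono : ∀ j, ∫ ω, φ j (fun t => a j t ω) ∂P ≤
      (if j = j₀ then lam j₀ * r ^ D else 1) *
        Real.exp (κ * ∑ s : N.window T t, q j s * lam j) := by
    intro j
    simp only [φ]
    split_ifs with h
    · subst h
      rw [mul_assoc]
      exact (hmom j).2 ⟨s₀, hs₀⟩
    · simp only [one_mul]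
      exact (hmom j).1
  simp only [hpt]
  rw [ha_types.integral_fun_prod_comp
    (fun j => (measurable_pi_iff.2 fun t => ha_meas j t).aemeasurable)
    fun j => (hφm j).aestronglyMeasurable]
  refine le_trans (Finset.prod_le_prod (fun j _ => integral_nonneg fun ω => ?_)
    fun j _ => hmono j) (le_of_eq ?_)
  · refine mul_nonneg ?_ (Finset.prod_nonneg fun s _ => pow_nonneg (hb j s) _)
    split_ifs
    · exact Nat.cast_nonneg _
    · exact zero_le_one
  · rw [Finset.prod_mul_distrib, Finset.prod_ite_eq', if_pos (Finset.mem_univ _), mul_assoc,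
      ← Real.exp_sum, ← Finset.mul_sum]
    congr 4
    exact Finset.sum_congr rfl fun j _ => Finset.sum_coe_sort (N.window T t) fun s => q j s * lam j

end Network

/-! ### Freezing the arrivals, measurability and integrability. -/

section Freezing

variable {Ω κ 𝓢 : Type*} [MeasurableSpace Ω] [MeasurableSpace κ] [MeasurableSpace 𝓢]
  {P : Measure Ω} [IsProbabilityMeasure P]

/-- Integrating a function of a countably valued variable and an independent one, by first freezing
the countably valued variable. -/
theorem ProbabilityTheory.IndepFun.integral_freeze [Countable κ] [MeasurableSingletonClass κ]
    {α : Ω → κ} {S : Ω → 𝓢} (hα : Measurable α) (hS : Measurable S) (hind : IndepFun α S P)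
    {Φ : κ → 𝓢 → ℝ} (hΦ : ∀ x, Measurable (Φ x)) {b : κ → ℝ} (hb : ∀ x s, ‖Φ x s‖ ≤ b x)
    (hbint : Integrable (fun ω => b (α ω)) P) :
    Integrable (fun ω => Φ (α ω) (S ω)) P ∧
      ∫ ω, Φ (α ω) (S ω) ∂P = ∫ ω, ∫ ω', Φ (α ω) (S ω') ∂P ∂P := by
  have hm : Measurable fun z : κ × 𝓢 => Φ z.1 z.2 := measurable_from_prod_countable_right hΦ
  have hαS : Measurable fun ω => (α ω, S ω) := hα.prodMk hS
  have hint : Integrable (fun ω => Φ (α ω) (S ω)) P :=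
    hbint.mono' (hm.comp hαS).aestronglyMeasurable (Filter.Eventually.of_forall fun ω => hb _ _)
  have := Measure.isProbabilityMeasure_map (μ := P) hα.aemeasurable
  have := Measure.isProbabilityMeasure_map (μ := P) hS.aemeasurable
  refine ⟨hint, ?_⟩
  have hprod := hind.map_prod_eq_prod_map_map hα.aemeasurable hS.aemeasurable
  have hint' : Integrable (fun z : κ × 𝓢 => Φ z.1 z.2) ((P.map α).prod (P.map S)) := by
    rw [← hprod]
    exact (integrable_map_measure hm.aestronglyMeasurable hαS.aemeasurable).2 hint
  calc ∫ ω, Φ (α ω) (S ω) ∂P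
      = ∫ z, Φ z.1 z.2 ∂(P.map fun ω => (α ω, S ω)) :=
        (integral_map hαS.aemeasurable hm.aestronglyMeasurable).symm
    _ = ∫ x, ∫ s, Φ x s ∂(P.map S) ∂(P.map α) := by rw [hprod, integral_prod _ hint']
    _ = ∫ ω, ∫ s, Φ (α ω) s ∂(P.map S) ∂P :=
        integral_map hα.aemeasurable (measurable_of_countable _).aestronglyMeasurable
    _ = _ := by
        congr 1
        ext ω
        exact integral_map hS.aemeasurable (hΦ _).aestronglyMeasurable

theorem integral_ite_one_zero {p : Ω → Prop} [DecidablePred p] (hp : MeasurableSet {ω | p ω}) :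
    ∫ ω, (if p ω then (1 : ℝ) else 0) ∂P = P.real {ω | p ω} := by
  rw [← integral_indicator_one hp]
  congr 1
  ext ω
  simp [Set.indicator_apply]

end Freezing

namespace Network

variable {V J : Type*} [Fintype V] [DecidableEq V] [Fintype J] (N : Network V J)

section Measurability

variable {Ω : Type*} [MeasurableSpace Ω] {T : ℕ} {A : J → ℕ → ℕ}
  {sel : Packet J → ℕ → V → Ω → Selection V} {rank : ℕ → Packet J → Ω → ℕ}

theorem measurableSet_requestAt (hsel : ∀ p τ v, Measurable (sel p τ v))
    {prev : Ω → Packet J → Option (V × V)}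
    (hprev : ∀ p ℓ, MeasurableSet {ω | prev ω p = some ℓ}) (t : ℕ) (p : Packet J) (ℓ : V × V) :
    MeasurableSet {ω | N.requestAt T A (fun p τ v => sel p τ v ω) (prev ω) t p = some ℓ} := by
  simp only [requestAt_eq_some_iff]
  rw [Set.ofPred_exists]
  refine MeasurableSet.iUnion fun v => MeasurableSet.inter ?_
    (hsel p _ v (measurableSet_selection {x | x = some ℓ}))
  change MeasurableSet {ω | N.nodeAt T A (prev ω) t p = some v}
  unfold nodeAt
  split_ifs
  · exact MeasurableSet.const _
  · exact MeasurableSet.const _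
  · simp only [Option.map_eq_some_iff]
    rw [Set.ofPred_exists]
    exact MeasurableSet.iUnion fun ℓ' => (hprev p ℓ').inter (MeasurableSet.const _)
  · exact MeasurableSet.const _

theorem measurableSet_sent (hsel : ∀ p τ v, Measurable (sel p τ v))
    (hrank : ∀ t p, Measurable (rank t p)) (t : ℕ) (p : Packet J) (ℓ : V × V) :
    MeasurableSet {ω | N.sent T A (fun p τ v => sel p τ v ω) (fun t p => rank t p ω) t p =
      some ℓ} := by
  classical
  induction t generalizing p ℓ with
  | zero =>
    simp only [sent]
    exact MeasurableSet.const _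
  | succ t ih =>
    set req : Ω → Packet J → Option (V × V) := fun ω q =>
      N.requestAt T A (fun p τ v => sel p τ v ω)
        (N.sent T A (fun p τ v => sel p τ v ω) (fun t p => rank t p ω) t) (t + 1) q with hreq
    have hreqm : ∀ q ℓ, MeasurableSet {ω | req ω q = some ℓ} := fun q ℓ =>
      N.measurableSet_requestAt hsel ih (t + 1) q ℓ
    -- Only arrived packets make requests, so the count over all packets is a finite sum of
    -- indicators.
    have hcount : ∀ ω, {q | req ω q = some ℓ ∧ rank (t + 1) q ω < rank (t + 1) p ω}.ncard =
        ∑ q ∈ arrivedPackets T A,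
          if req ω q = some ℓ ∧ rank (t + 1) q ω < rank (t + 1) p ω then 1 else 0 := by
      intro ω
      rw [← Finset.card_filter, ← Set.ncard_coe_finset]
      congr 1
      ext q
      simp only [Finset.coe_filter, Set.mem_ofPred_eq]
      exact ⟨fun h => ⟨(Finset.mem_filter.1 (N.mem_walkers_of_requestAt t h.1)).1, h⟩,
        fun h => h.2⟩
    have hcountm : Measurable fun ω =>
        {q | req ω q = some ℓ ∧ rank (t + 1) q ω < rank (t + 1) p ω}.ncard := by
      simp only [hcount]
      refine Finset.measurable_sum _ fun q _ => Measurable.ite ?_ measurable_const measurable_const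
      exact (hreqm q ℓ).inter (measurableSet_lt (hrank _ _) (hrank _ _))
    have hset : {ω | N.sent T A (fun p τ v => sel p τ v ω) (fun t p => rank t p ω) (t + 1) p =
        some ℓ} = {ω | req ω p = some ℓ} ∩ {ω | ℓ ∈ N.links →
          {q | req ω q = some ℓ ∧ rank (t + 1) q ω < rank (t + 1) p ω}.ncard < N.cap ℓ} := by
      ext ω
      simp only [Set.mem_inter_iff, Set.mem_ofPred_eq, sent, forwardAt, Option.bind_eq_some_iff]
      constructor
      · rintro ⟨ℓ', h1, h2⟩
        split_ifs at h2 with h3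
        obtain rfl : ℓ' = ℓ := by simpa using h2
        exact ⟨h1, h3⟩
      · rintro ⟨h1, h2⟩
        exact ⟨ℓ, h1, if_pos h2⟩
    rw [hset]
    refine (hreqm p ℓ).inter ?_
    by_cases hℓ : ℓ ∈ N.links
    · simp only [hℓ, true_imp_iff]
      exact measurableSet_lt hcountm measurable_const
    · simp only [hℓ, false_imp_iff]
      exact MeasurableSet.const _

theorem measurable_fbpfReward (hsel : ∀ p τ v, Measurable (sel p τ v))
    (hrank : ∀ t p, Measurable (rank t p)) :
    Measurable fun ω => N.fbpfReward T A (fun p τ v => sel p τ v ω) (fun t p => rank t p ω) := by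
  unfold fbpfReward reward
  refine Finset.measurable_sum _ fun t _ => Finset.measurable_sum _ fun j _ =>
    Measurable.const_mul (Finset.measurable_sum _ fun n _ => Finset.measurable_sum _ fun k _ => ?_) _
  have h1 : MeasurableSet {ω | ∀ τ : Fin (N.deadline j + 1),
      N.sent T A (fun p τ v => sel p τ v ω) (fun t p => rank t p ω) (t + τ) (j, t, n) =
        some (k τ)} := by
    rw [Set.ofPred_forall]
    exact MeasurableSet.iInter fun τ => N.measurableSet_sent hsel hrank _ _ _
  have h2 : Measurable fun ω => N.fbpfDecisions T A (fun p τ v => sel p τ v ω)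
      (fun t p => rank t p ω) j t n k := Measurable.ite h1 measurable_const measurable_const
  exact (measurable_of_countable fun n : ℕ => (n : ℝ)).comp h2

theorem fbpfReward_nonneg (S : Packet J → ℕ → V → Selection V) (R : ℕ → Packet J → ℕ) :
    0 ≤ N.fbpfReward T A S R := by
  unfold fbpfReward reward
  exact Finset.sum_nonneg fun _ _ => Finset.sum_nonneg fun j _ => mul_nonneg (N.weight_nonneg j)
    (Finset.sum_nonneg fun _ _ => Finset.sum_nonneg fun _ _ => Nat.cast_nonneg _)

theorem fbpfReward_le (S : Packet J → ℕ → V → Selection V) (R : ℕ → Packet J → ℕ) :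
    N.fbpfReward T A S R ≤ N.reward T A fun _ _ _ _ => 1 := by
  unfold fbpfReward reward
  refine Finset.sum_le_sum fun t _ => Finset.sum_le_sum fun j _ =>
    mul_le_mul_of_nonneg_left (Finset.sum_le_sum fun n _ => Finset.sum_le_sum fun k _ => ?_)
      (N.weight_nonneg j)
  rw [Nat.cast_le, fbpfDecisions]
  split_ifs <;> norm_num

/-- Truncated arrivals take countably many values, so joint measurability reduces to measurability
for each fixed arrival sequence. -/
theorem measurable_fbpfReward_arrivals (hsel : ∀ p τ v, Measurable (sel p τ v))
    (hrank : ∀ t p, Measurable (rank t p)) {a : J → ℕ → Ω → ℕ}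
    (ha_meas : ∀ j t, Measurable (a j t)) :
    Measurable fun ω => N.fbpfReward T (fun j t => a j t ω) (fun p τ v => sel p τ v ω)
      (fun t p => rank t p ω) := by
  let F : (J → Finset.Icc 1 T → ℕ) × Ω → ℝ := fun z =>
    N.fbpfReward T (truncateArrivals T z.1) (fun p τ v => sel p τ v z.2) (fun t p => rank t p z.2)
  have h0 : ∀ α, Measurable fun ω => N.fbpfReward T (truncateArrivals T α)
      (fun p τ v => sel p τ v ω) (fun t p => rank t p ω) :=
    fun α => N.measurable_fbpfReward hsel hrank
  have h1 : Measurable F := measurable_from_prod_countable_right h0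
  let g : Ω → (J → Finset.Icc 1 T → ℕ) × Ω := fun ω => (fun j t => a j t ω, ω)
  have hα : Measurable fun ω j (t : Finset.Icc 1 T) => a j t ω :=
    measurable_pi_iff.2 fun j => measurable_pi_iff.2 fun t => ha_meas j t
  have h2 : Measurable g := hα.prodMk measurable_id
  have h3 : (fun ω => N.fbpfReward T (fun j t => a j t ω) (fun p τ v => sel p τ v ω)
      fun t p => rank t p ω) = fun ω => F (g ω) := by
    funext ω
    exact N.fbpfReward_congr (fun j t ht =>
      (truncateArrivals_restrict (fun j t => a j t ω) j t ht).symm) _ _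
  rw [h3]
  exact h1.comp h2

end Measurability

end Network

theorem DependencyDegreeLE.exists_ae_forall_le {J Ω : Type*} [Fintype J] [MeasurableSpace Ω]
    {P : Measure Ω} {T D : ℕ} {W : ℕ → Finset ℕ} (hW : ∀ t ∈ Finset.Icc 1 T, t ∈ W t)
    {a : J → ℕ → Ω → ℕ} (ha_meas : ∀ j t, Measurable (a j t))
    (ha_dep : ∀ j, ∀ t ∈ Finset.Icc 1 T, DependencyDegreeLE P (fun (s : W t) => a j s) D) :
    ∃ M : ℕ, ∀ᵐ ω ∂P, ∀ j, ∀ t ∈ Finset.Icc 1 T, a j t ω ≤ M * D := by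
  have h1 : ∀ j (t : Finset.Icc 1 T), ∃ m : ℕ, ∀ᵐ ω ∂P, a j t ω ≤ m * D := by
    intro j t
    obtain ⟨m, hm⟩ := (ha_dep j t t.2).exists_ae_le_mul fun s => ha_meas j s
    refine ⟨m, hm.mono fun ω hω => le_trans ?_ hω⟩
    exact Finset.single_le_sum (f := fun s : W t => a j s ω) (fun _ _ => Nat.zero_le _)
      (Finset.mem_univ ⟨t, hW t t.2⟩)
  choose m hm using h1
  refine ⟨∑ j, ∑ t, m j t, ?_⟩
  filter_upwards [ae_all_iff.2 fun j => ae_all_iff.2 fun t => hm j t] with ω hω j t ht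
  refine (hω j ⟨t, ht⟩).trans (Nat.mul_le_mul_right _ ?_)
  calc m j ⟨t, ht⟩ ≤ ∑ t, m j t :=
        Finset.single_le_sum (f := fun t => m j t) (fun _ _ => Nat.zero_le _) (Finset.mem_univ _)
    _ ≤ _ := Finset.single_le_sum (f := fun j => ∑ t, m j t) (fun _ _ => Nat.zero_le _)
        (Finset.mem_univ j)

/-- Bounded arrivals take finitely many values almost surely, so no growth condition on `φ` is
needed. -/
theorem integrable_comp_of_ae_le {J Ω : Type*} [Fintype J] [MeasurableSpace Ω] {P : Measure Ω}
    [IsProbabilityMeasure P] {T M : ℕ} {a : J → ℕ → Ω → ℕ} (ha_meas : ∀ j t, Measurable (a j t))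
    (hM : ∀ᵐ ω ∂P, ∀ j, ∀ t ∈ Finset.Icc 1 T, a j t ω ≤ M)
    (φ : (J → Finset.Icc 1 T → ℕ) → ℝ) :
    Integrable (fun ω => φ fun j t => a j t ω) P := by
  classical
  have hα : Measurable fun ω j (t : Finset.Icc 1 T) => a j t ω :=
    measurable_pi_iff.2 fun j => measurable_pi_iff.2 fun t => ha_meas j t
  have hfin : {α : J → Finset.Icc 1 T → ℕ | α ≤ fun _ _ => M}.Finite := Set.finite_Iic _
  refine Integrable.of_bound ((measurable_of_countable φ).comp hα).aestronglyMeasurable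
    (∑ α ∈ hfin.toFinset, ‖φ α‖) ?_
  filter_upwards [hM] with ω hω
  exact Finset.single_le_sum (f := fun α => ‖φ α‖) (fun _ _ => norm_nonneg _)
    (hfin.mem_toFinset.2 fun j t => hω j t t.2)

/-! ### Expected weight of the free walks and expected loss by overload. -/

namespace Network

variable {V J : Type*} [Fintype V] [DecidableEq V] [Fintype J] (N : Network V J)

section FixedArrivals

variable (T : ℕ) (A : J → ℕ → ℕ)

theorem measurableSet_overload (p : Packet J) (k : N.Route p.1) (ℓ : V × V) (t : ℕ) :
    MeasurableSet {S : Packet J → ℕ → V → Selection V | S p ∈ N.walkSet p.1 k ∧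
      N.cap ℓ < (N.walkers T A S ℓ t).card} := by
  classical
  have h1 : Measurable fun S : Packet J → ℕ → V → Selection V => (N.walkers T A S ℓ t).card := by
    simp only [walkers, Finset.card_filter]
    refine Finset.measurable_sum _ fun q _ => ?_
    have hq : Measurable fun S : Packet J → ℕ → V → Selection V => S q := measurable_pi_apply q
    exact Measurable.ite (hq (N.measurableSet_walkers ℓ t q)) measurable_const measurable_const
  exact (measurable_pi_apply p (N.measurableSet_walkSet p.1 k)).inter
    (measurableSet_lt measurable_const h1)

theorem measurable_walkWeight : Measurable (N.walkWeight T A) := by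
  classical
  refine Finset.measurable_sum _ fun p _ => Measurable.const_mul
    (Finset.measurable_sum _ fun k _ => Measurable.ite ?_ measurable_const measurable_const) _
  exact measurable_pi_apply p (N.measurableSet_walkSet p.1 k)

theorem measurable_overloadWeight : Measurable (N.overloadWeight T A) := by
  classical
  refine Finset.measurable_sum _ fun p _ => Measurable.const_mul
    (Finset.measurable_sum _ fun k _ => Finset.measurable_sum _ fun τ _ => ?_) _
  split_ifs
  · exact Measurable.ite (N.measurableSet_overload T A p k _ _) measurable_const measurable_const
  · exact measurable_const

theorem norm_walkWeight_le (S : Packet J → ℕ → V → Selection V) :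
    ‖N.walkWeight T A S‖ ≤
      ∑ p ∈ arrivedPackets T A, N.weight p.1 * ∑ _k ∈ N.routeSchedules p.1, (1 : ℝ) := by
  rw [Real.norm_of_nonneg]
  · refine Finset.sum_le_sum fun p _ => mul_le_mul_of_nonneg_left
      (Finset.sum_le_sum fun k _ => ?_) (N.weight_nonneg _)
    split_ifs <;> norm_num
  · refine Finset.sum_nonneg fun p _ => mul_nonneg (N.weight_nonneg _)
      (Finset.sum_nonneg fun k _ => ?_)
    split_ifs <;> norm_num

theorem norm_overloadWeight_le (S : Packet J → ℕ → V → Selection V) :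
    ‖N.overloadWeight T A S‖ ≤ ∑ p ∈ arrivedPackets T A, N.weight p.1 *
      ∑ _k ∈ N.routeSchedules p.1, ∑ _τ : Fin (N.deadline p.1 + 1), (1 : ℝ) := by
  rw [Real.norm_of_nonneg]
  · refine Finset.sum_le_sum fun p _ => mul_le_mul_of_nonneg_left
      (Finset.sum_le_sum fun k _ => Finset.sum_le_sum fun τ _ => ?_) (N.weight_nonneg _)
    split_ifs <;> norm_num
  · refine Finset.sum_nonneg fun p _ => mul_nonneg (N.weight_nonneg _)
      (Finset.sum_nonneg fun k _ => Finset.sum_nonneg fun τ _ => ?_)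
    split_ifs <;> norm_num

variable {Ω : Type*} [MeasurableSpace Ω] {P : Measure Ω} [IsProbabilityMeasure P]
  {f : Forwarding V J} {sel : Packet J → ℕ → V → Ω → Selection V}

theorem IsSelection.measurable_all (hsel : N.IsSelection P f sel) :
    Measurable fun ω p τ v => sel p τ v ω :=
  measurable_pi_iff.2 fun p => hsel.measurable_packet N p

theorem IsSelection.integral_walkWeight (hsel : N.IsSelection P f sel) :
    ∫ ω, N.walkWeight T A (fun p τ v => sel p τ v ω) ∂P =
      ∑ j, ∑ t ∈ Finset.Icc 1 T, (A j t : ℝ) *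
        (N.weight j * ∑ k ∈ N.routeSchedules j, N.routeProb f j k) := by
  classical
  have hm : ∀ (p : Packet J) (k : N.Route p.1),
      MeasurableSet {ω | (fun τ v => sel p τ v ω) ∈ N.walkSet p.1 k} := fun p k =>
    hsel.measurable_packet N p (N.measurableSet_walkSet p.1 k)
  have hi : ∀ (p : Packet J) (k : N.Route p.1), Integrable
      (fun ω => if (fun τ v => sel p τ v ω) ∈ N.walkSet p.1 k then (1 : ℝ) else 0) P :=
    fun p k => Integrable.of_bound (Measurable.ite (hm p k) measurable_const
      measurable_const).aestronglyMeasurable 1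
      (Filter.Eventually.of_forall fun ω => by split_ifs <;> simp)
  have h1 : ∫ ω, N.walkWeight T A (fun p τ v => sel p τ v ω) ∂P =
      ∑ p ∈ arrivedPackets T A, N.weight p.1 * ∑ k ∈ N.routeSchedules p.1,
        N.routeProb f p.1 k := by
    unfold walkWeight
    rw [integral_finsetSum _ fun p _ =>
      (integrable_finsetSum _ fun k _ => hi p k).const_mul _]
    refine Finset.sum_congr rfl fun p _ => ?_
    rw [integral_const_mul, integral_finsetSum _ fun k _ => hi p k]
    congr 1
    refine Finset.sum_congr rfl fun k hk => ?_
    rw [← hsel.prob_walkSet N p hk]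
    exact integral_ite_one_zero (hm p k)
  rw [h1, sum_arrivedPackets]
  simp

/-- The tail bound is the same for all packets of one type and slot, so summing over them produces
the factor `A j t`, which becomes the size-biasing once the arrivals are averaged. -/
theorem IsSelection.integral_overloadWeight_le {lam : J → ℝ} {ε : ℝ}
    (hf : N.LPFeasible lam ε f) (hsel : N.IsSelection P f sel) {r : ℝ} (hr : 1 ≤ r) :
    ∫ ω, N.overloadWeight T A (fun p τ v => sel p τ v ω) ∂P ≤
      ∑ j, ∑ t ∈ Finset.Icc 1 T, N.weight j * ∑ k ∈ N.routeSchedules j,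
        ∑ τ : Fin (N.deadline j + 1), if k τ ∈ N.links then
          N.routeProb f j k * (r ^ N.cap (k τ))⁻¹ * (A j t * ∏ j', ∏ s ∈ Finset.Icc 1 T,
            (1 + N.flowAt f (k τ) (t + τ) j' s * (r - 1)) ^ A j' s) else 0 := by
  classical
  have hm : ∀ (p : Packet J) (k : N.Route p.1) (ℓ : V × V) (t : ℕ),
      MeasurableSet {ω | (fun τ v => sel p τ v ω) ∈ N.walkSet p.1 k ∧
        N.cap ℓ < (N.walkers T A (fun p τ v => sel p τ v ω) ℓ t).card} := fun p k ℓ t =>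
    hsel.measurable_all N (N.measurableSet_overload T A p k ℓ t)
  have hi : ∀ (p : Packet J) (k : N.Route p.1) (ℓ : V × V) (t : ℕ), Integrable
      (fun ω => if ℓ ∈ N.links then (if (fun τ v => sel p τ v ω) ∈ N.walkSet p.1 k ∧
        N.cap ℓ < (N.walkers T A (fun p τ v => sel p τ v ω) ℓ t).card then (1 : ℝ) else 0)
        else 0) P := by
    intro p k ℓ t
    split_ifs
    · exact Integrable.of_bound (Measurable.ite (hm p k ℓ t) measurable_const
        measurable_const).aestronglyMeasurable 1
        (Filter.Eventually.of_forall fun ω => by split_ifs <;> simp)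
    · exact integrable_zero _ _ _
  have h1 : ∫ ω, N.overloadWeight T A (fun p τ v => sel p τ v ω) ∂P ≤
      ∑ p ∈ arrivedPackets T A, N.weight p.1 * ∑ k ∈ N.routeSchedules p.1,
        ∑ τ : Fin (N.deadline p.1 + 1), if k τ ∈ N.links then
          N.routeProb f p.1 k * (r ^ N.cap (k τ))⁻¹ * ∏ j', ∏ s ∈ Finset.Icc 1 T,
            (1 + N.flowAt f (k τ) (p.2.1 + τ) j' s * (r - 1)) ^ A j' s else 0 := by
    unfold overloadWeight
    rw [integral_finsetSum _ fun p _ => (integrable_finsetSum _ fun k _ =>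
      integrable_finsetSum _ fun τ _ => hi p k _ _).const_mul _]
    refine Finset.sum_le_sum fun p hp => ?_
    rw [integral_const_mul, integral_finsetSum _ fun k _ =>
      integrable_finsetSum _ fun τ _ => hi p k _ _]
    refine mul_le_mul_of_nonneg_left (Finset.sum_le_sum fun k hk => ?_) (N.weight_nonneg _)
    rw [integral_finsetSum _ fun τ _ => hi p k _ _]
    refine Finset.sum_le_sum fun τ _ => ?_
    split_ifs with hℓ
    · refine le_trans (le_of_eq ?_) (hsel.prob_overload_le N hf T A hp hk τ _ hr)
      exact integral_ite_one_zero (hm p k _ _)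
    · simp
  refine h1.trans (le_of_eq ?_)
  rw [sum_arrivedPackets]
  refine Finset.sum_congr rfl fun j _ => Finset.sum_congr rfl fun t _ => ?_
  change ∑ _n ∈ Finset.Icc 1 (A j t), N.weight j * (∑ k ∈ N.routeSchedules j,
    ∑ τ : Fin (N.deadline j + 1), if k τ ∈ N.links then
      N.routeProb f j k * (r ^ N.cap (k τ))⁻¹ * ∏ j', ∏ s ∈ Finset.Icc 1 T,
        (1 + N.flowAt f (k τ) (t + τ) j' s * (r - 1)) ^ A j' s else 0) = _
  simp only [Finset.sum_const, Nat.card_Icc, Nat.add_sub_cancel, nsmul_eq_mul]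
  rw [mul_left_comm, Finset.mul_sum]
  congr 1
  refine Finset.sum_congr rfl fun k _ => ?_
  rw [Finset.mul_sum]
  refine Finset.sum_congr rfl fun τ _ => ?_
  split_ifs <;> ring

end FixedArrivals

theorem card_links_le_maxRouteLength {j : J} {k : N.Route j} (hk : k ∈ N.routeSchedules j) :
    (Finset.univ.filter fun τ => k τ ∈ N.links).card ≤ N.maxRouteLength :=
  (Finset.le_sup (f := fun k : N.Route j => (Finset.univ.filter fun τ => k τ ∈ N.links).card)
    hk).trans (Finset.le_sup (f := fun j => (N.routeSchedules j).sup fun k =>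
      (Finset.univ.filter fun τ => k τ ∈ N.links).card) (Finset.mem_univ j))

section RandomArrivals

variable {Ω : Type*} [MeasurableSpace Ω] {P : Measure Ω} [IsProbabilityMeasure P] {T D : ℕ}
  {ε : ℝ} {a : J → ℕ → Ω → ℕ} {lam : J → ℝ} {f : Forwarding V J}
  {sel : Packet J → ℕ → V → Ω → Selection V}

theorem indepFun_arrivals_restrict {𝓢 : Type*} [MeasurableSpace 𝓢] {S : Ω → 𝓢}
    (hind : IndepFun (fun ω j t => a j t ω) S P) :
    IndepFun (fun ω j (t : Finset.Icc 1 T) => a j t ω) S P := by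
  have hφ : Measurable fun (x : J → ℕ → ℕ) j (t : Finset.Icc 1 T) => x j t := by fun_prop
  exact hind.comp hφ measurable_id

theorem integral_walkWeight_arrivals (ha_meas : ∀ j t, Measurable (a j t))
    (hint : ∀ φ : (J → Finset.Icc 1 T → ℕ) → ℝ, Integrable (fun ω => φ fun j t => a j t ω) P)
    (ha_rate : ∀ j, ∀ t ∈ Finset.Icc 1 T, ∫ ω, (a j t ω : ℝ) ∂P = lam j)
    (hsel : N.IsSelection P f sel)
    (hind : IndepFun (fun ω j t => a j t ω) (fun ω p τ v => sel p τ v ω) P) :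
    Integrable (fun ω => N.walkWeight T (fun j t => a j t ω) (fun p τ v => sel p τ v ω)) P ∧
      ∫ ω, N.walkWeight T (fun j t => a j t ω) (fun p τ v => sel p τ v ω) ∂P =
        T * ∑ j, N.weight j * lam j * ∑ k ∈ N.routeSchedules j, N.routeProb f j k := by
  have hα : Measurable fun ω j (t : Finset.Icc 1 T) => a j t ω :=
    measurable_pi_iff.2 fun j => measurable_pi_iff.2 fun t => ha_meas j t
  have hind' : IndepFun (fun ω j (t : Finset.Icc 1 T) => a j t ω)
      (fun ω p τ v => sel p τ v ω) P :=
    indepFun_arrivals_restrict hind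
  have hcongr : ∀ ω (S : Packet J → ℕ → V → Selection V),
      N.walkWeight T (fun j t => a j t ω) S =
        N.walkWeight T (truncateArrivals T fun j t => a j t ω) S := by
    intro ω S
    rw [walkWeight, walkWeight,
      arrivedPackets_congr (truncateArrivals_restrict fun j t => a j t ω)]
  have h := hind'.integral_freeze hα (hsel.measurable_all N)
    (Φ := fun α S => N.walkWeight T (truncateArrivals T α) S)
    (fun α => N.measurable_walkWeight T _) (fun α S => N.norm_walkWeight_le T _ S)
    (hint fun α => ∑ p ∈ arrivedPackets T (truncateArrivals T α),
      N.weight p.1 * ∑ _k ∈ N.routeSchedules p.1, (1 : ℝ))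
  simp only [hcongr]
  refine ⟨h.1, h.2.trans ?_⟩
  simp only [hsel.integral_walkWeight N]
  have hi : ∀ j, ∀ t ∈ Finset.Icc 1 T, Integrable (fun ω => (a j t ω : ℝ)) P := fun j t ht =>
    hint fun α => (α j ⟨t, ht⟩ : ℝ)
  have h2 : ∀ ω, ∑ j, ∑ t ∈ Finset.Icc 1 T,
      (truncateArrivals T (fun j (t : Finset.Icc 1 T) => a j t ω) j t : ℝ) *
        (N.weight j * ∑ k ∈ N.routeSchedules j, N.routeProb f j k) =
      ∑ j, ∑ t ∈ Finset.Icc 1 T, (a j t ω : ℝ) *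
        (N.weight j * ∑ k ∈ N.routeSchedules j, N.routeProb f j k) := fun ω =>
    Finset.sum_congr rfl fun j _ => Finset.sum_congr rfl fun t ht => by
      rw [truncateArrivals_restrict (fun j t => a j t ω) j t ht]
  simp only [h2]
  rw [integral_finsetSum _ fun j _ => integrable_finsetSum _ fun t ht => (hi j t ht).mul_const _,
    Finset.mul_sum]
  refine Finset.sum_congr rfl fun j _ => ?_
  rw [integral_finsetSum _ fun t ht => (hi j t ht).mul_const _]
  rw [Finset.sum_congr rfl fun t ht => by rw [integral_mul_const, ha_rate j t ht]]
  simp only [Finset.sum_const, Nat.card_Icc, Nat.add_sub_cancel, nsmul_eq_mul]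
  ring

/-- Each link of a route loses at most a fraction `(1 + ε) * (ε / L)` of the route's expected
weight, and a union bound over its at most `L` links removes the `L`. -/
theorem integral_overloadWeight_arrivals_le (hε : 0 < ε) (hD : 0 < D)
    (ha_meas : ∀ j t, Measurable (a j t))
    (hint : ∀ φ : (J → Finset.Icc 1 T → ℕ) → ℝ, Integrable (fun ω => φ fun j t => a j t ω) P)
    (hlam : ∀ j, 0 ≤ lam j)
    (ha_rate : ∀ j, ∀ t ∈ Finset.Icc 1 T, ∫ ω, (a j t ω : ℝ) ∂P = lam j)
    (ha_types : iIndepFun (fun j ω t => a j t ω) P)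
    (ha_dep : ∀ j, ∀ t ∈ Finset.Icc 1 (T + N.dmax),
      DependencyDegreeLE P (fun (s : N.window T t) => a j s) D)
    (hf : N.LPFeasible lam ε f) (hsel : N.IsSelection P f sel)
    (hind : IndepFun (fun ω j t => a j t ω) (fun ω p τ v => sel p τ v ω) P)
    (hC : ∀ ℓ ∈ N.links,
      2 * (D : ℝ) * ((1 + ε) / ε) ^ 2 * Real.log ((N.maxRouteLength : ℝ) / ε) ≤ (N.cap ℓ : ℝ)) :
    Integrable (fun ω => N.overloadWeight T (fun j t => a j t ω) (fun p τ v => sel p τ v ω)) P ∧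
      ∫ ω, N.overloadWeight T (fun j t => a j t ω) (fun p τ v => sel p τ v ω) ∂P ≤
        (1 + ε) * ε *
          (T * ∑ j, N.weight j * lam j * ∑ k ∈ N.routeSchedules j, N.routeProb f j k) := by
  -- The value `1 + ε` of `r ^ D` minimizes the Chernoff exponent at mean load `C / (1 + ε)`.
  obtain ⟨r, hr, hrD⟩ : ∃ r : ℝ, 1 ≤ r ∧ r ^ D = 1 + ε :=
    ⟨(1 + ε) ^ ((D : ℝ)⁻¹), Real.one_le_rpow (by linarith) (by positivity),
      Real.rpow_inv_natCast_pow (by linarith) hD.ne'⟩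
  have hα : Measurable fun ω j (t : Finset.Icc 1 T) => a j t ω :=
    measurable_pi_iff.2 fun j => measurable_pi_iff.2 fun t => ha_meas j t
  have hind' : IndepFun (fun ω j (t : Finset.Icc 1 T) => a j t ω)
      (fun ω p τ v => sel p τ v ω) P :=
    indepFun_arrivals_restrict hind
  have hcongr : ∀ ω (S : Packet J → ℕ → V → Selection V),
      N.overloadWeight T (fun j t => a j t ω) S =
        N.overloadWeight T (truncateArrivals T fun j t => a j t ω) S := by
    intro ω S
    have hA := arrivedPackets_congr (truncateArrivals_restrict (T := T) fun j t => a j t ω)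
    have hw : N.walkers T (fun j t => a j t ω) S =
        N.walkers T (truncateArrivals T fun j t => a j t ω) S := by
      funext ℓ t
      rw [walkers, walkers, hA]
    rw [overloadWeight, overloadWeight, hw, hA]
  have h := hind'.integral_freeze hα (hsel.measurable_all N)
    (Φ := fun α S => N.overloadWeight T (truncateArrivals T α) S)
    (fun α => N.measurable_overloadWeight T _) (fun α S => N.norm_overloadWeight_le T _ S)
    (hint fun α => ∑ p ∈ arrivedPackets T (truncateArrivals T α), N.weight p.1 *
      ∑ _k ∈ N.routeSchedules p.1, ∑ _τ : Fin (N.deadline p.1 + 1), (1 : ℝ))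
  simp only [hcongr]
  refine ⟨h.1, h.2.trans_le ?_⟩
  let G : (j : J) → ℕ → (k : N.Route j) → Fin (N.deadline j + 1) → (J → ℕ → ℕ) → ℝ :=
    fun j t k τ A => A j t * ∏ j', ∏ s ∈ Finset.Icc 1 T,
      (1 + N.flowAt f (k τ) (t + τ) j' s * (r - 1)) ^ A j' s
  let H : (J → ℕ → ℕ) → ℝ := fun A => ∑ j, ∑ t ∈ Finset.Icc 1 T, N.weight j *
    ∑ k ∈ N.routeSchedules j, ∑ τ : Fin (N.deadline j + 1), if k τ ∈ N.links then
      N.routeProb f j k * (r ^ N.cap (k τ))⁻¹ * G j t k τ A else 0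
  have hGcongr : ∀ ω j, ∀ t ∈ Finset.Icc 1 T, ∀ k τ,
      G j t k τ (truncateArrivals T fun j (t : Finset.Icc 1 T) => a j t ω) =
        G j t k τ fun j t => a j t ω := by
    intro ω j t ht k τ
    simp only [G]
    rw [truncateArrivals_restrict (fun j t => a j t ω) j t ht]
    congr 1
    exact Finset.prod_congr rfl fun j' _ => Finset.prod_congr rfl fun s hs => by
      rw [truncateArrivals_restrict (fun j t => a j t ω) j' s hs]
  have hHcongr : ∀ ω, H (truncateArrivals T fun j (t : Finset.Icc 1 T) => a j t ω) =
      H fun j t => a j t ω := fun ω =>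
    Finset.sum_congr rfl fun j _ => Finset.sum_congr rfl fun t ht => by
      simp only [hGcongr ω j t ht]
  have hGint : ∀ j, ∀ t ∈ Finset.Icc 1 T, ∀ k τ,
      Integrable (fun ω => G j t k τ fun j t => a j t ω) P := by
    intro j t ht k τ
    refine (hint fun α => G j t k τ (truncateArrivals T α)).congr
      (Filter.Eventually.of_forall fun ω => hGcongr ω j t ht k τ)
  have hint1 : Integrable (fun ω => ∫ ω', N.overloadWeight T
      (truncateArrivals T fun j (t : Finset.Icc 1 T) => a j t ω)
      (fun p τ v => sel p τ v ω') ∂P) P :=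
    hint fun α => ∫ ω', N.overloadWeight T (truncateArrivals T α) (fun p τ v => sel p τ v ω') ∂P
  have hint2 : Integrable (fun ω => H fun j t => a j t ω) P :=
    (hint fun α => H (truncateArrivals T α)).congr (Filter.Eventually.of_forall hHcongr)
  have htail : ∀ j, ∀ t ∈ Finset.Icc 1 T, ∀ k ∈ N.routeSchedules j,
      ∀ τ : Fin (N.deadline j + 1), k τ ∈ N.links →
      (r ^ N.cap (k τ))⁻¹ * ∫ ω, G j t k τ (fun j t => a j t ω) ∂P ≤
        lam j * ((1 + ε) * (ε / N.maxRouteLength)) := by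
    intro j t ht k hk τ hℓ
    have hτd : (τ : ℕ) ≤ N.dmax := (Nat.lt_succ_iff.1 τ.2).trans (N.deadline_le_dmax j)
    have hL : 0 < N.maxRouteLength := by
      refine lt_of_lt_of_le (Finset.card_pos.2 ⟨τ, ?_⟩) (N.card_links_le_maxRouteLength hk)
      exact Finset.mem_filter.2 ⟨Finset.mem_univ _, hℓ⟩
    have hall : k τ ∈ N.allLinks := Finset.mem_union_left _ hℓ
    obtain ⟨ht1, ht2⟩ := Finset.mem_Icc.1 ht
    have hmom := N.integral_mul_prod_pow_le hD ha_meas ha_rate ha_types (t := t + τ)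
      (fun j => ha_dep j (t + τ) (Finset.mem_Icc.2 ⟨by omega, by omega⟩))
      (q := N.flowAt f (k τ) (t + τ)) (fun j s => hsel.flowAt_mem_Icc N hf hall _ j s)
      (fun j s hs hsw => N.flowAt_eq_zero hs hsw) hr j (s₀ := t)
      (by simp only [window, Finset.mem_Icc]; omega)
    have hch := chernoff_factor_le hD hε (Nat.cast_pos.2 hL) (hC _ hℓ) (zero_lt_one.trans_le hr)
      hrD (hf.sum_flowAt_le N hlam hℓ T (t + τ))
    calc _ ≤ (r ^ N.cap (k τ))⁻¹ * (lam j * (r ^ D * Real.exp ((r ^ D - 1) / D *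
          ∑ j, ∑ s ∈ N.window T (t + τ), N.flowAt f (k τ) (t + τ) j s * lam j))) :=
          mul_le_mul_of_nonneg_left hmom (by positivity)
      _ = lam j * ((r ^ N.cap (k τ))⁻¹ * (r ^ D * Real.exp ((r ^ D - 1) / D *
          ∑ j, ∑ s ∈ N.window T (t + τ), N.flowAt f (k τ) (t + τ) j s * lam j))) := by ring
      _ ≤ _ := mul_le_mul_of_nonneg_left hch (hlam j)
  have hterm : ∀ j, ∀ t ∈ Finset.Icc 1 T, ∀ k ∈ N.routeSchedules j,
      ∑ τ : Fin (N.deadline j + 1), (if k τ ∈ N.links then N.routeProb f j k *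
        (r ^ N.cap (k τ))⁻¹ * ∫ ω, G j t k τ (fun j t => a j t ω) ∂P else 0) ≤
      N.routeProb f j k * (lam j * ((1 + ε) * ε)) := by
    intro j t ht k hk
    have hπ := N.routeProb_nonneg hf j k
    calc _ ≤ ∑ τ : Fin (N.deadline j + 1), (if k τ ∈ N.links then N.routeProb f j k *
          (lam j * ((1 + ε) * (ε / N.maxRouteLength))) else 0) := by
          refine Finset.sum_le_sum fun τ _ => ?_
          split_ifs with hℓ
          · rw [mul_assoc]
            exact mul_le_mul_of_nonneg_left (htail j t ht k hk τ hℓ) hπ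
          · exact le_rfl
      _ = (Finset.univ.filter fun τ => k τ ∈ N.links).card * (N.routeProb f j k *
          (lam j * ((1 + ε) * (ε / N.maxRouteLength)))) := by
          rw [← Finset.sum_filter, Finset.sum_const, nsmul_eq_mul]
      _ ≤ N.maxRouteLength * (N.routeProb f j k *
          (lam j * ((1 + ε) * (ε / N.maxRouteLength)))) := by
          have := hlam j
          have h0 := N.card_links_le_maxRouteLength hk
          gcongr
      _ = N.routeProb f j k * (lam j * ((1 + ε) * (N.maxRouteLength * (ε / N.maxRouteLength)))) := by
          ring
      _ ≤ _ := by
          refine mul_le_mul_of_nonneg_left (mul_le_mul_of_nonneg_left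
            (mul_le_mul_of_nonneg_left ?_ (by positivity)) (hlam j)) hπ
          -- With `L = 0` no route uses a link and the product is `0`, not `ε`; an inequality is all
          -- that is needed.
          rcases Nat.eq_zero_or_pos N.maxRouteLength with h0 | h0
          · simp [h0, hε.le]
          · rw [mul_div_cancel₀ _ (Nat.cast_pos.2 h0).ne']
  have hsumint : ∀ j, ∀ t ∈ Finset.Icc 1 T, ∀ k (τ : Fin (N.deadline j + 1)),
      Integrable (fun ω => if k τ ∈ N.links then N.routeProb f j k * (r ^ N.cap (k τ))⁻¹ *
        G j t k τ (fun j t => a j t ω) else 0) P := by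
    intro j t ht k τ
    split_ifs
    · exact (hGint j t ht k τ).const_mul _
    · exact integrable_zero _ _ _
  calc _ ≤ ∫ ω, H (fun j t => a j t ω) ∂P := by
        refine integral_mono hint1 hint2 fun ω => ?_
        refine (hsel.integral_overloadWeight_le N T _ hf hr).trans (le_of_eq (hHcongr ω))
    _ = ∑ j, ∑ t ∈ Finset.Icc 1 T, N.weight j * ∑ k ∈ N.routeSchedules j,
          ∑ τ : Fin (N.deadline j + 1), (if k τ ∈ N.links then N.routeProb f j k *
            (r ^ N.cap (k τ))⁻¹ * ∫ ω, G j t k τ (fun j t => a j t ω) ∂P else 0) := by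
        simp only [H]
        rw [integral_finsetSum _ fun j _ => integrable_finsetSum _ fun t ht =>
          (integrable_finsetSum _ fun k _ => integrable_finsetSum _ fun τ _ =>
            hsumint j t ht k τ).const_mul _]
        refine Finset.sum_congr rfl fun j _ => ?_
        rw [integral_finsetSum _ fun t ht =>
          (integrable_finsetSum _ fun k _ => integrable_finsetSum _ fun τ _ =>
            hsumint j t ht k τ).const_mul _]
        refine Finset.sum_congr rfl fun t ht => ?_
        rw [integral_const_mul, integral_finsetSum _ fun k _ => integrable_finsetSum _ fun τ _ =>
            hsumint j t ht k τ]
        congr 1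
        refine Finset.sum_congr rfl fun k _ => ?_
        rw [integral_finsetSum _ fun τ _ => hsumint j t ht k τ]
        refine Finset.sum_congr rfl fun τ _ => ?_
        split_ifs
        · rw [integral_const_mul]
        · simp
    _ ≤ ∑ j, ∑ t ∈ Finset.Icc 1 T, N.weight j * ∑ k ∈ N.routeSchedules j,
          N.routeProb f j k * (lam j * ((1 + ε) * ε)) :=
        Finset.sum_le_sum fun j _ => Finset.sum_le_sum fun t ht => mul_le_mul_of_nonneg_left
          (Finset.sum_le_sum fun k hk => hterm j t ht k hk) (N.weight_nonneg j)
    _ = _ := by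
        simp only [Finset.sum_const, Nat.card_Icc, Nat.add_sub_cancel, nsmul_eq_mul,
          ← Finset.sum_mul]
        rw [Finset.mul_sum, Finset.mul_sum]
        refine Finset.sum_congr rfl fun j _ => ?_
        ring

end RandomArrivals

end Network

end

/-! ### Combination of the bounds. -/

theorem theorem3 {V J Ω : Type*} [Fintype V] [DecidableEq V] [Fintype J] [MeasurableSpace Ω]
    (P : Measure Ω) [IsProbabilityMeasure P]
    (N : Network V J) (T D : ℕ) (ε : ℝ) (hε0 : 0 < ε) (hε1 : ε < 1 / 3)
    -- arrivals: constant rates, independent types, dependency degree at most D in every window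
    (a : J → ℕ → Ω → ℕ) (lam : J → ℝ)
    (ha_meas : ∀ j t, Measurable (a j t))
    (ha_rate : ∀ j, ∀ t ∈ Finset.Icc 1 T, ∫ ω, (a j t ω : ℝ) ∂P = lam j)
    (ha_types : iIndepFun (fun j ω t => a j t ω) P)
    (ha_dep : ∀ j, ∀ t ∈ Finset.Icc 1 (T + N.dmax),
      DependencyDegreeLE P (fun (s : N.window T t) => a j s) D)
    -- the algorithm: any optimal LP solution, its random selections, any processing order
    (f : Network.Forwarding V J) (hf : N.LPOptimal lam ε f)
    (sel : Packet J → ℕ → V → Ω → Selection V) (hsel : N.IsSelection P f sel)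
    (hsel_arrivals : IndepFun (fun ω j t => a j t ω) (fun ω p τ v => sel p τ v ω) P)
    (rank : ℕ → Packet J → Ω → ℕ) (hrank_meas : ∀ t p, Measurable (rank t p))
    (hrank_inj : ∀ t ω, Function.Injective fun p => rank t p ω)
    -- capacity and horizon
    (hC : ∀ ℓ ∈ N.links,
      2 * (D : ℝ) * ((1 + ε) / ε) ^ 2 * Real.log ((N.maxRouteLength : ℝ) / ε) ≤ (N.cap ℓ : ℝ))
    (hT : 2 * (N.dmax : ℝ) ^ 2 / ε ≤ (T : ℝ)) :
    ProvidesApproximation P (1 - 3 * ε)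
      (fun ω => N.fbpfReward T (fun j t => a j t ω) (fun p τ v => sel p τ v ω)
        (fun t p => rank t p ω))
      (fun ω => N.optRI T (fun j t => a j t ω)) := by
  obtain ⟨M, hM⟩ := DependencyDegreeLE.exists_ae_forall_le (P := P) (T := T) (W := N.window T)
    (fun t ht => by simp only [Network.window, Finset.mem_Icc] at ht ⊢; omega) ha_meas
    (fun j t ht => ha_dep j t (by simp only [Finset.mem_Icc] at ht ⊢; omega))
  have hint := integrable_comp_of_ae_le ha_meas hM
  set W : Ω → ℝ := fun ω => N.fbpfReward T (fun j t => a j t ω) (fun p τ v => sel p τ v ω)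
    (fun t p => rank t p ω) with hWdef
  have hW0 : ∀ ω, 0 ≤ W ω := fun ω => N.fbpfReward_nonneg _ _
  have hWint : Integrable W P := by
    refine (hint fun α => N.reward T (Network.truncateArrivals T α) fun _ _ _ _ => 1).mono'
      (N.measurable_fbpfReward_arrivals hsel.measurable hrank_meas ha_meas).aestronglyMeasurable
      (Filter.Eventually.of_forall fun ω => ?_)
    rw [Real.norm_of_nonneg (hW0 ω),
      N.reward_congr (Network.truncateArrivals_restrict fun j t => a j t ω)]
    exact N.fbpfReward_le _ _
  have hOint : Integrable (fun ω => N.optRI T fun j t => a j t ω) P :=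
    (hint fun α => N.optRI T (Network.truncateArrivals T α)).congr
      (Filter.Eventually.of_forall fun ω =>
        N.optRI_congr (Network.truncateArrivals_restrict fun j t => a j t ω))
  refine ⟨hWint, hOint, ?_⟩
  have hWnn : 0 ≤ ∫ ω, W ω ∂P := integral_nonneg hW0
  rcases Nat.eq_zero_or_pos T with rfl | hT0
  · have hO : ∀ ω, N.optRI 0 (fun j t => a j t ω) = 0 := fun ω => by
      obtain ⟨y, -, hy⟩ := N.exists_reward_eq_optRI 0 fun j t => a j t ω
      rw [hy]
      simp [Network.reward]
    simp only [hO, integral_zero, mul_zero]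
    exact hWnn
  have hlam : ∀ j, 0 ≤ lam j := fun j => by
    rw [← ha_rate j 1 (Finset.mem_Icc.2 ⟨le_rfl, hT0⟩)]
    exact integral_nonneg fun ω => Nat.cast_nonneg _
  have hopt := N.integral_optRI_le hε0 hT0 hint ha_rate hf
  -- The Chernoff bound takes a `D`-th root. For `D = 0` there are almost surely no arrivals, all
  -- rates vanish, and the LP bound makes the expected optimum nonpositive.
  rcases Nat.eq_zero_or_pos D with rfl | hD
  · have hlam0 : ∀ j, lam j = 0 := fun j => by
      rw [← ha_rate j 1 (Finset.mem_Icc.2 ⟨le_rfl, hT0⟩)]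
      refine integral_eq_zero_of_ae (hM.mono fun ω hω => ?_)
      have := hω j 1 (Finset.mem_Icc.2 ⟨le_rfl, hT0⟩)
      simpa using this
    have h0 : N.lpObjective lam f = 0 := by simp [Network.lpObjective, hlam0]
    rw [h0, mul_zero] at hopt
    exact (mul_nonpos_of_nonneg_of_nonpos (by linarith) hopt).trans hWnn
  obtain ⟨hVint, hV⟩ := N.integral_walkWeight_arrivals ha_meas hint ha_rate hsel hsel_arrivals
  obtain ⟨hLint, hL⟩ := N.integral_overloadWeight_arrivals_le hε0 hD ha_meas hint hlam ha_rate
    ha_types ha_dep hf.1 hsel hsel_arrivals hC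
  have hVWL := integral_mono hVint (hWint.add hLint) fun ω =>
    N.walkWeight_le T (fun j t => a j t ω) (fun p τ v => sel p τ v ω) (fun t p => rank t p ω)
  rw [integral_add' hWint hLint, hV] at hVWL
  have hobj0 : 0 ≤ N.lpObjective lam f := by
    refine Finset.sum_nonneg fun j _ => mul_nonneg (mul_nonneg (N.weight_nonneg j) (hlam j))
      (Finset.sum_nonneg fun ℓ hℓ => hf.1.nonneg j ℓ (Finset.mem_filter.1 hℓ).1 0 (Nat.zero_le _))
  have hobj : N.lpObjective lam f ≤
      ∑ j, N.weight j * lam j * ∑ k ∈ N.routeSchedules j, N.routeProb f j k :=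
    Finset.sum_le_sum fun j _ => mul_le_mul_of_nonneg_left (hsel.le_sum_routeProb N hf.1 j)
      (mul_nonneg (N.weight_nonneg j) (hlam j))
  set Q := ∑ j, N.weight j * lam j * ∑ k ∈ N.routeSchedules j, N.routeProb f j k
  set O := N.lpObjective lam f
  -- A natural number is at most its square, so the quadratic horizon condition yields this linear
  -- bound.
  have hd : (N.dmax : ℝ) ≤ ε * T / 2 := by
    have h1 : 2 * (N.dmax : ℝ) ^ 2 ≤ T * ε := (div_le_iff₀ hε0).1 hT
    have h2 : (N.dmax : ℝ) ≤ (N.dmax : ℝ) ^ 2 := by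
      exact_mod_cast Nat.le_self_pow two_ne_zero N.dmax
    linarith
  have hTpos : (0 : ℝ) < T := Nat.cast_pos.2 hT0
  have hεε : 0 ≤ 1 - (1 + ε) * ε := by nlinarith
  calc (1 - 3 * ε) * ∫ ω, N.optRI T (fun j t => a j t ω) ∂P
      ≤ (1 - 3 * ε) * ((T + N.dmax) * (1 + ε) * O) :=
        mul_le_mul_of_nonneg_left hopt (by linarith)
    _ ≤ (1 - 3 * ε) * ((T + ε * T / 2) * (1 + ε) * O) := by
        have : 0 ≤ 1 - 3 * ε := by linarith
        gcongr
    _ = ((1 - 3 * ε) * (1 + ε / 2) * (1 + ε)) * (T * O) := by ring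
    _ ≤ (1 - (1 + ε) * ε) * (T * O) := by
        refine mul_le_mul_of_nonneg_right ?_ (by positivity)
        -- The left-hand factor expands to `1 - 3 * ε / 2 - 4 * ε ^ 2 - 3 * ε ^ 3 / 2`, the
        -- right-hand one to `1 - ε - ε ^ 2`.
        nlinarith [sq_nonneg ε, mul_pos hε0 hε0, mul_pos (mul_pos hε0 hε0) hε0]
    _ ≤ (1 - (1 + ε) * ε) * (T * Q) := by gcongr
    _ ≤ ∫ ω, W ω ∂P := by linarith
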